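/- A represented space is a set $X$ with a partial surjection $\delta_X:\subseteq\mathbb N^{\mathbb N}\to X$; if $\delta_X(p)=x$, then $p$ is a name of $x$. A problem is a partial multi-valued function $f:\subseteq X\rightrightarrows Y$ between represented spaces, and $f\le_W g$ denotes Weihrauch reducibility: there are computable $\Phi,\Psi:\subseteq\mathbb N^{\mathbb N}\to\mathbb N^{\mathbb N}$ such that for every name $p$ of a point $x\in\mathrm{dom}(f)$, $\Phi(p)$ is a name of some $z\in\mathrm{dom}(g)$, and for every name $r$ of an element of $g(z)$, $\Psi(p\oplus r)$ is a name of an element of $f(x)$. Write $f\equiv_W g$ if $f\le_W g$ and $g\le_W f$. The set $\mathbb N^{\mathbb N}$ is represented by the identity, and $n\in\mathbb N$ has the name $n,0,0,\dots$. A problem is first-order if its values lie in $\mathbb N$. A first-order part ${}^1P$ of a problem $P$ is a $\le_W$-greatest element of the class of first-order problems $Q$ with $Q\le_W P$ (it is unique up to $\equiv_W$). A countable ordered group is named by a presentation whose domain is a subset of $\mathbb N$ (the characteristic function of the domain, the multiplication, and the characteristic function of the linear order, which is invariant under left and right multiplication). A countable ordinal $\alpha$ is named by the characteristic functions of a set $A\subseteq\mathbb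 N$ and a relation ${<_A}\subseteq A\times A$ that well-orders $A$ in type $\alpha$ (a copy of $\alpha$). Let $\mathbb Z^\alpha$ be the set of finitely supported functions $\alpha\to\mathbb Z$, compared at the largest point at which they differ, and let $\mathbb Z^\alpha\mathbb Q$ be $\mathbb Z^\alpha\times\mathbb Q$ with the $\mathbb Q$-coordinate compared first. $\mathsf{OG\mapsto\alpha}$ is the problem: given a countable ordered group $G$, output a copy of an ordinal $\alpha$ such that $G$ is order isomorphic to $\mathbb Z^\alpha$ or to $\mathbb Z^\alpha\mathbb Q$. For $p\in\mathbb N^{\mathbb N}$ let $\mathsf{LPO}(p)=0$ if $p(n)=0$ for some $n$, and $\mathsf{LPO}(p)=1$ otherwise; let $\mathsf{Min}(p)=\min\{p(n):n\in\mathbb N\}$. Let $\mathsf{LPO}^*$ be the finite parallelization of $\mathsf{LPO}$: given $k\in\mathbb N$ and $p_0,\dots,p_{k-1}\in\mathbb N^{\mathbb N}$, output $k$ and $\mathsf{LPO}(p_0),\dots,\mathsf{LPO}(p_{k-1})$. Proposition. $\mathsf{OG\mapsto\alpha}$ has a first-order part, and every first-order part of it satisfies $${}^1\mathsf{OG\mapsto\alpha}\equiv_W\mathsf{LPO}^*\equiv_W\mathsf{Min}.$$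 Moreover: (upper bound) for every problem $P$ whose values are countable ordinals, named by their copies, every first-order problem $Q\le_W P$ satisfies $Q\le_W\mathsf{LPO}^*$; in particular, any first-order part of $P$ is Weihrauch reducible to $\mathsf{LPO}^*$; (lower bound) $\mathsf{LPO}^*\le_W\mathsf{OG\mapsto\alpha}$. -/

import Mathlib

universe u v w t

namespace Weihrauch

/-- Baire space `ℕ^ℕ`. -/
abbrev Baire := ℕ → ℕ

/-- The finite initial segment `p(0), …, p(n-1)` of `p`. -/
def initSeg (p : Baire) (n : ℕ) : List ℕ := (List.range n).map p

/-- A partial function on Baire space is computable if it is given by a total computable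
function on finite strings that is monotone for the prefix order. -/
def ComputableFunctional (F : Baire →. Baire) : Prop :=
  ∃ g : List ℕ → List ℕ, Computable g ∧
    (∀ σ τ : List ℕ, σ <+: τ → g σ <+: g τ) ∧
    ∀ x y : Baire, y ∈ F x ↔ ∀ n, ∃ m, initSeg y n <+: g (initSeg x m)

/-- The join `p ⊕ q`: `p` on the even positions, `q` on the odd positions. -/
def join (p q : Baire) : Baire := fun n => if n % 2 = 0 then p (n / 2) else q (n / 2)

/-- A represented space: `IsName` is the graph of a partial surjection from Baire space
onto the carrier. -/
structure RepSpace where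
  Carrier : Type u
  IsName : Baire → Carrier → Prop
  functional : ∀ p x y, IsName p x → IsName p y → x = y
  surjective : ∀ x, ∃ p, IsName p x

instance : CoeSort RepSpace.{u} (Type u) := ⟨RepSpace.Carrier⟩

/-- A problem, i.e. a partial multi-valued function `f :⊆ X ⇉ Y`, given as a relation;
`f x` is the set of values at `x`. -/
abbrev Problem (X : RepSpace.{u}) (Y : RepSpace.{v}) := X → Set Y

/-- The domain of a problem: the points that have at least one value. -/
def dom {X : RepSpace.{u}} {Y : RepSpace.{v}} (f : Problem X Y) : Set X :=
  {x | (f x).Nonempty}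

/-- Weihrauch reducibility `f ≤_W g`. Here `r` ranges over all names of all values in `g z`,
i.e. over all values that a realizer of `g` can take at the name `q` of `z`. -/
def WLE {X : RepSpace.{u}} {Y : RepSpace.{v}} {Z : RepSpace.{w}} {W : RepSpace.{t}}
    (f : Problem X Y) (g : Problem Z W) : Prop :=
  ∃ Φ Ψ : Baire →. Baire, ComputableFunctional Φ ∧ ComputableFunctional Ψ ∧
    ∀ (p : Baire) (x : X), X.IsName p x → x ∈ dom f →
      ∃ q ∈ Φ p, ∃ z : Z, Z.IsName q z ∧ z ∈ dom g ∧
        ∀ (r : Baire) (y : W), W.IsName r y → y ∈ g z →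
          ∃ s ∈ Ψ (join p r), ∃ y' : Y, Y.IsName s y' ∧ y' ∈ f x

/-- Weihrauch equivalence `f ≡_W g`. -/
def WEquiv {X : RepSpace.{u}} {Y : RepSpace.{v}} {Z : RepSpace.{w}} {W : RepSpace.{t}}
    (f : Problem X Y) (g : Problem Z W) : Prop :=
  WLE f g ∧ WLE g f

/-- Baire space, represented by the identity. -/
def baireRep : RepSpace.{0} where
  Carrier := Baire
  IsName p x := p = x
  functional := fun _ _ _ h h' => h.symm.trans h'
  surjective := fun x => ⟨x, rfl⟩

/-- The natural numbers; the name of `n` is the sequence `n, 0, 0, 0, …`. -/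
def natRep : RepSpace.{0} where
  Carrier := ℕ
  IsName p n := p 0 = n ∧ ∀ m, 0 < m → p m = 0
  functional := fun _ _ _ h h' => h.1.symm.trans h'.1
  surjective := fun n => ⟨fun m => if m = 0 then n else 0, by simp, fun m hm => by
    simp [hm.ne']⟩

/-- The space `X^*` of words over `X`. A name `p` of a word of length `i` has `p 0 = i`, and
`m ↦ p (⟨j, m⟩ + 1)` is a name of its `j`-th letter for each `j < i`. -/
def starRep (X : RepSpace.{u}) : RepSpace.{u} where
  Carrier := Σ i : ℕ, Fin i → X
  IsName p a := p 0 = a.1 ∧ ∀ j : Fin a.1, X.IsName (fun m => p (Nat.pair j m + 1)) (a.2 j)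
  functional := by
    rintro p ⟨i, x⟩ ⟨i', x'⟩ ⟨h, hx⟩ ⟨h', hx'⟩
    obtain rfl : i = i' := h.symm.trans h'
    obtain rfl : x = x' := funext fun j => X.functional _ _ _ (hx j) (hx' j)
    rfl
  surjective := by
    rintro ⟨i, x⟩
    choose q hq using fun j => X.surjective (x j)
    refine ⟨fun n => match n with
      | 0 => i
      | n + 1 => if h : n.unpair.1 < i then q ⟨n.unpair.1, h⟩ n.unpair.2 else 0, rfl, ?_⟩
    intro j
    have := hq j
    simpa using this

/-- The finite parallelization `f^*`. -/
def star {X : RepSpace.{u}} {Y : RepSpace.{v}} (f : Problem X Y) :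
    Problem (starRep X) (starRep Y) :=
  fun a => {b | ∃ y : Fin a.1 → Y, b = ⟨a.1, y⟩ ∧ ∀ j, y j ∈ f (a.2 j)}

open Classical in
/-- The limited principle of omniscience. -/
noncomputable def LPO : Problem baireRep natRep :=
  fun p : Baire => {if ∃ n, p n = 0 then (0 : ℕ) else (1 : ℕ)}

/-- The problem `Min`: the minimum of the values of a sequence. -/
def Min : Problem baireRep natRep :=
  fun p : Baire => {k : ℕ | IsLeast (Set.range p) k}

/-- A problem with values in `ℕ` is a first-order problem. `Q` is the first-order part of `P` if
it is the greatest, for `≤_W`, of the first-order problems that are Weihrauch reducible to `P`.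
(Every represented space is in bijection with a quotient of a set of sequences of natural
numbers, so that nothing is lost by taking the instances of first-order problems in `Type`.) -/
structure IsFirstOrderPart {X : RepSpace.{u}} {Y : RepSpace.{v}} {Z : RepSpace.{0}}
    (Q : Problem Z natRep) (P : Problem X Y) : Prop where
  le : WLE Q P
  greatest : ∀ (Z' : RepSpace.{0}) (R : Problem Z' natRep), WLE R P → WLE R Q

/-- An ordered group whose domain is a set of natural numbers. (The order of the group is
written `linearOrder.le`, because `≤` would denote the usual order of natural numbers here.) -/
structure NatOrderedGroup where
  carrier : Set ℕ
  group : Group carrier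
  linearOrder : LinearOrder carrier
  mul_le_mul_right : ∀ a b g : carrier, linearOrder.le a b → linearOrder.le (a * g) (b * g)
  mul_le_mul_left : ∀ a b g : carrier, linearOrder.le a b → linearOrder.le (g * a) (g * b)

/-- The type of elements of `G`, with the group structure and the order of `G`
(and not the order inherited from the natural numbers). -/
def NatOrderedGroup.Elem (G : NatOrderedGroup) : Type := G.carrier

instance (G : NatOrderedGroup) : Group G.Elem := G.group

instance (G : NatOrderedGroup) : LinearOrder G.Elem := G.linearOrder

/-- The natural number that an element of `G` is. -/
def NatOrderedGroup.Elem.toNat {G : NatOrderedGroup} (a : G.Elem) : ℕ := Subtype.val a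

open Classical in
/-- The sequence `p` codes the ordered group `G`: the values `p (3n)` give the characteristic
function of its domain, and on the domain the values `p (3⟨a,b⟩ + 1)` give the multiplication
and the values `p (3⟨a,b⟩ + 2)` the characteristic function of the order. -/
def CodesGroup (p : Baire) (G : NatOrderedGroup) : Prop :=
  (∀ n, p (3 * n) = if n ∈ G.carrier then 1 else 0) ∧
  (∀ a b : G.Elem, p (3 * Nat.pair a.toNat b.toNat + 1) = (a * b).toNat) ∧
  (∀ a b : G.Elem, p (3 * Nat.pair a.toNat b.toNat + 2) = if a ≤ b then 1 else 0)

theorem CodesGroup.le_iff {p : Baire} {G : NatOrderedGroup} (h : CodesGroup p G) (a b : G.Elem) :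
    p (3 * Nat.pair a.toNat b.toNat + 2) = 1 ↔ a ≤ b := by
  rw [h.2.2 a b]
  split_ifs with hab <;> simp [hab]

theorem CodesGroup.functional (p : Baire) (G H : NatOrderedGroup)
    (hG : CodesGroup p G) (hH : CodesGroup p H) : G = H := by
  have k := hG.le_iff
  have k' := hH.le_iff
  obtain ⟨C, g, o, r, l⟩ := G
  obtain ⟨C', g', o', r', l'⟩ := H
  obtain ⟨h1, h2, h3⟩ := hG
  obtain ⟨h1', h2', h3'⟩ := hH
  obtain rfl : C = C' := by
    ext n
    have h := (h1 n).symm.trans (h1' n)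
    by_cases hn : n ∈ C <;> by_cases hn' : n ∈ C' <;> simp_all
  obtain rfl : g = g' := by
    apply Group.ext
    ext a b
    exact (h2 a b).symm.trans (h2' a b)
  obtain rfl : o = o' := by
    apply LinearOrder.ext
    intro a b
    exact (k a b).symm.trans (k' a b)
  rfl

open Classical in
theorem CodesGroup.surjective (G : NatOrderedGroup) : ∃ p, CodesGroup p G := by
  let elem (n : ℕ) (h : n ∈ G.carrier) : G.Elem := ⟨n, h⟩
  refine ⟨fun n =>
    if n % 3 = 0 then (if n / 3 ∈ G.carrier then 1 else 0)
    else if h : (n / 3).unpair.1 ∈ G.carrier ∧ (n / 3).unpair.2 ∈ G.carrier then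
      (if n % 3 = 1 then (elem _ h.1 * elem _ h.2).toNat
      else if elem _ h.1 ≤ elem _ h.2 then 1 else 0)
    else 0, ?_, ?_, ?_⟩
  · intro n
    simp
  · rintro ⟨a, ha⟩ ⟨b, hb⟩
    have e1 : (3 * Nat.pair a b + 1) % 3 = 1 := by omega
    have e2 : (3 * Nat.pair a b + 1) / 3 = Nat.pair a b := by omega
    simp [NatOrderedGroup.Elem.toNat, e1, e2, ha, hb, elem]
  · rintro ⟨a, ha⟩ ⟨b, hb⟩
    have e1 : (3 * Nat.pair a b + 2) % 3 = 2 := by omega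
    have e2 : (3 * Nat.pair a b + 2) / 3 = Nat.pair a b := by omega
    simp [NatOrderedGroup.Elem.toNat, e1, e2, ha, hb, elem]

/-- The represented space of countable ordered groups, given by presentations on sets of
natural numbers. -/
def ogRep : RepSpace.{0} where
  Carrier := NatOrderedGroup
  IsName := CodesGroup
  functional := CodesGroup.functional
  surjective := CodesGroup.surjective

/-- The set `A ⊆ ℕ` coded by the even positions of `p`. -/
def copySet (p : Baire) : Set ℕ := {n | p (2 * n) = 1}

/-- The relation `<_A` on `A` coded by the odd positions of `p`. -/
def copyRel (p : Baire) (a b : copySet p) : Prop := p (2 * Nat.pair a b + 1) = 1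

/-- The sequence `p` is an `ω`-copy of the ordinal `o`: it consists of the characteristic
functions of a set `A ⊆ ℕ` and of a relation `<_A ⊆ A × A` that is a well-order of `A` of
type `o`. -/
def IsCopy (p : Baire) (o : Ordinal.{0}) : Prop :=
  (∀ n, p n = 0 ∨ p n = 1) ∧
  (∀ a b, p (2 * Nat.pair a b + 1) = 1 → a ∈ copySet p ∧ b ∈ copySet p) ∧
  ∃ _h : IsWellOrder (copySet p) (copyRel p), Ordinal.type (copyRel p) = o

open Classical in
theorem IsCopy.surjective (o : Ordinal.{0}) (ho : o.card ≤ Cardinal.aleph0) :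
    ∃ p, IsCopy p o := by
  have hc : Countable o.ToType := by
    rw [← Cardinal.mk_le_aleph0_iff, Cardinal.mk_toType]
    exact ho
  obtain ⟨f, hf⟩ := exists_injective_nat o.ToType
  set p : Baire := fun n =>
    if n % 2 = 0 then (if n / 2 ∈ Set.range f then 1 else 0)
    else if ∃ x y : o.ToType, x < y ∧ n / 2 = Nat.pair (f x) (f y) then 1 else 0 with hp
  have hA : ∀ n, n ∈ copySet p ↔ n ∈ Set.range f := by
    intro n
    simp [copySet, hp]
  have hR : ∀ a b, p (2 * Nat.pair a b + 1) = 1 ↔ ∃ x y : o.ToType, x < y ∧ f x = a ∧ f y = b := by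
    intro a b
    have e1 : (2 * Nat.pair a b + 1) % 2 = 1 := by omega
    have e2 : (2 * Nat.pair a b + 1) / 2 = Nat.pair a b := by omega
    simp [hp, e1, e2, Nat.pair_eq_pair, eq_comm]
  let e : o.ToType ≃ copySet p := Equiv.ofBijective (fun x => ⟨f x, (hA _).2 ⟨x, rfl⟩⟩)
    ⟨fun x y h => hf (congrArg Subtype.val h), fun ⟨n, hn⟩ => by
      obtain ⟨x, hx⟩ := (hA n).1 hn
      exact ⟨x, Subtype.ext hx⟩⟩
  have he : ∀ x y, copyRel p (e x) (e y) ↔ x < y := by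
    intro x y
    refine (hR _ _).trans ⟨?_, fun h => ⟨x, y, h, rfl, rfl⟩⟩
    rintro ⟨x', y', h, hx, hy⟩
    rw [← hf hx, ← hf hy]
    exact h
  let E : ((· < ·) : o.ToType → o.ToType → Prop) ≃r copyRel p := ⟨e, fun {a b} => he a b⟩
  have hw : IsWellOrder (copySet p) (copyRel p) := E.symm.toRelEmbedding.isWellOrder
  refine ⟨p, ?_, ?_, hw, ?_⟩
  · intro n
    simp only [hp]
    split_ifs <;> simp
  · intro a b h
    obtain ⟨x, y, -, hx, hy⟩ := (hR a b).1 h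
    exact ⟨(hA a).2 ⟨x, hx⟩, (hA b).2 ⟨y, hy⟩⟩
  · rw [← Ordinal.type_toType o]
    exact (Ordinal.type_eq.2 ⟨E⟩).symm

/-- The represented space of countable ordinals: the names of `α` are the `ω`-copies of `α`. -/
def ordRep : RepSpace.{1} where
  Carrier := {o : Ordinal.{0} // o.card ≤ Cardinal.aleph0}
  IsName p o := IsCopy p o.1
  functional := by
    rintro p ⟨x, hx⟩ ⟨y, hy⟩ ⟨_, _, _, h⟩ ⟨_, _, _, h'⟩
    exact Subtype.ext (h.symm.trans h')
  surjective := fun o => IsCopy.surjective o.1 o.2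

/-- The linear order `ℤ^X`: finitely supported functions `X → ℤ`, compared at the greatest
point at which they differ. -/
abbrev ZPow (X : Type u) := Colex (X →₀ ℤ)

/-- The order type of `G` is `ℤ^α` (without a dense part) or `ℤ^α ℚ`. In the product `ℤ^α ℚ` the
`ℚ`-coordinate is compared first, which is the lexicographic order on `ℚ × ℤ^α`. -/
def HasOrderType (G : NatOrderedGroup) (α : Ordinal.{0}) : Prop :=
  Nonempty (G.Elem ≃o ZPow α.ToType) ∨ Nonempty (G.Elem ≃o ℚ ×ₗ ZPow α.ToType)

/-- The problem `OG ↦ α`: given a countable ordered group `G`, find (a copy of) an ordinal `α`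
such that the order type of `G` is `ℤ^α` or `ℤ^α ℚ`. By Maltsev's theorem every countable ordered
group is in the domain of this problem. -/
def OGalpha : Problem ogRep ordRep :=
  fun G : NatOrderedGroup => {α | HasOrderType G α.1}

end Weihrauch

namespace Weihrauch

/-! ### Initial segments of sequences -/

section InitSeg

/-! `Min` itself is a first-order part of `OGalpha`: it lies below `OGalpha` by `min_wle_OGalpha`,
and every first-order problem below a problem with ordinal values lies below `Min` by
`wle_min_of_wle_ordRep`. Together with `min_wle_star_lpo`, `star_lpo_wle_min` and `WLE.trans` this
gives every clause.

Upper bound. A finite piece of a copy shows a finite linear order, of size `k` say, and is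
compatible with every countable ordinal that is at least `k`: the missing points go on top and get
large labels (`exists_isCopy_of_length_le`). The backward functional fixes its natural number after
reading such a piece. So if `α` is a correct ordinal, its answer on any piece of size at most `α` is
correct, and an answer on some such piece exists (`IsCopy.exists_list`). The ordinal `α` is unknown,
but the least size of a piece with an answer is at most `α`, and finding it is an instance of `Min`.

Lower bound. From `p` with minimum `m` one computes a linear order `I` on the natural numbers that
starts with `m` points and whose remaining part has no least element (`Idx`). The group `ℤ^I` is
computable from `p`. The power of `ℤ` over the remaining part is a countable dense order without
endpoints, so `ℤ^I` has type `ℤ^m ℚ` (`zpow_iso_rat_prod`). The exponent is an invariant of the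
order: by `finClass_zpow_iff`, the `n`-th finite condensation forgets exactly the first `n`
coordinates, so the condensations grow strictly up to level `m` and are stationary from there to the
next level. Hence `α = m` for either shape (`HasOrderType.eq_natCast`). A copy of `m` approximates
`m` from below by the number of points seen, while the terms of `p` are bounds from above; a term
that equals the number of points seen is the minimum. -/

@[simp] theorem length_initSeg (p : Baire) (n : ℕ) : (initSeg p n).length = n := by
  simp [initSeg]

theorem getElem?_initSeg (p : Baire) (n i : ℕ) :
    (initSeg p n)[i]? = if i < n then some (p i) else none := by
  split_ifs with h <;> simp [initSeg, h]

@[simp] theorem getElem_initSeg (p : Baire) (n i : ℕ) (h : i < (initSeg p n).length) :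
    (initSeg p n)[i] = p i := by
  simp [initSeg]

theorem getD_initSeg {p : Baire} {n i : ℕ} (h : i < n) (d : ℕ) : (initSeg p n).getD i d = p i := by
  simp [List.getD_eq_getElem?_getD, h]

theorem take_initSeg (p : Baire) {m n : ℕ} (h : m ≤ n) : (initSeg p n).take m = initSeg p m := by
  simp [initSeg, ← List.map_take, List.take_range, h]

theorem initSeg_prefix (p : Baire) {m n : ℕ} (h : m ≤ n) : initSeg p m <+: initSeg p n := by
  rw [← take_initSeg p h]
  exact List.take_prefix _ _

theorem initSeg_congr {p q : Baire} {n : ℕ} (h : ∀ i < n, p i = q i) : initSeg p n = initSeg q n :=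
  List.map_congr_left fun i hi => h i (List.mem_range.1 hi)

end InitSeg

/-! ### Search by stages -/

section FirstSome

/-- The first value among `f 0, …, f (n - 1)` that is defined. -/
def firstSome {σ : Type*} (f : ℕ → Option σ) (n : ℕ) : Option σ :=
  n.rec none fun i acc => acc.casesOn (f i) some

theorem firstSome_succ {σ : Type*} (f : ℕ → Option σ) (n : ℕ) :
    firstSome f (n + 1) = (firstSome f n).casesOn (f n) some := rfl

theorem firstSome_mono {σ : Type*} {f : ℕ → Option σ} {m n : ℕ} {v : σ}
    (h : firstSome f m = some v) (hmn : m ≤ n) : firstSome f n = some v := by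
  induction n, hmn using Nat.le_induction with
  | base => exact h
  | succ n _ ih => rw [firstSome_succ, ih]

theorem exists_of_firstSome {σ : Type*} {f : ℕ → Option σ} {n : ℕ} {v : σ}
    (h : firstSome f n = some v) : ∃ i < n, f i = some v := by
  induction n with
  | zero => simp [firstSome] at h
  | succ n ih =>
    rw [firstSome_succ] at h
    cases h' : firstSome f n with
    | none =>
      rw [h'] at h
      exact ⟨n, n.lt_succ_self, h⟩
    | some w =>
      rw [h'] at h
      obtain ⟨i, hi, e⟩ := ih (h'.trans h)
      exact ⟨i, by omega, e⟩

theorem firstSome_isSome {σ : Type*} {f : ℕ → Option σ} {n i : ℕ} {v : σ} (hi : i < n)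
    (h : f i = some v) : ∃ w, firstSome f n = some w := by
  suffices ∃ w, firstSome f (i + 1) = some w from
    this.imp fun w hw => firstSome_mono hw hi
  rw [firstSome_succ]
  cases firstSome f i with
  | none => exact ⟨v, h⟩
  | some w => exact ⟨w, rfl⟩

theorem firstSome_congr {σ : Type*} {f g : ℕ → Option σ} {n : ℕ} (h : ∀ i < n, f i = g i) :
    firstSome f n = firstSome g n := by
  induction n with
  | zero => rfl
  | succ n ih =>
    rw [firstSome_succ, firstSome_succ, ih fun i hi => h i (by omega), h n n.lt_succ_self]

theorem computable_firstSome {α σ : Type*} [Primcodable α] [Primcodable σ]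
    {f : α → ℕ → Option σ} {n : α → ℕ} (hf : Computable₂ f) (hn : Computable n) :
    Computable fun a => firstSome (f a) (n a) :=
  (Computable.nat_rec hn (Computable.const none)
    (Computable.option_casesOn (Computable.snd.comp Computable.snd)
      (hf.comp Computable.fst (Computable.fst.comp Computable.snd))
      (Computable.option_some.comp Computable.snd).to₂).to₂).of_eq fun _ => rfl

/-- The values `f 0, f 1, …` up to the first one that is undefined, and at most `n` of them. -/
def collect (f : ℕ → Option ℕ) (n : ℕ) : List ℕ :=
  n.rec [] fun i acc =>
    bif acc.length == i then (f i).casesOn acc fun v => acc ++ [v] else acc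

theorem collect_succ (f : ℕ → Option ℕ) (n : ℕ) : collect f (n + 1) =
    bif (collect f n).length == n then (f n).casesOn (collect f n) fun v => collect f n ++ [v]
    else collect f n := rfl

theorem computable_collect {α : Type*} [Primcodable α] {f : α → ℕ → Option ℕ} {n : α → ℕ}
    (hf : Computable₂ f) (hn : Computable n) : Computable fun a => collect (f a) (n a) := by
  have hacc : Computable fun x : α × ℕ × List ℕ => x.2.2 := Computable.snd.comp Computable.snd
  have hi : Computable fun x : α × ℕ × List ℕ => x.2.1 := Computable.fst.comp Computable.snd
  have heq : Computable₂ fun a b : ℕ => (a == b) := by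
    have := (primrecRel_iff_primrec_decide.1 (Primrec.eq (α := ℕ))).to_comp
    exact this.of_eq fun x => by
      rcases x with ⟨a, b⟩
      by_cases h : a = b <;> simp [h]
  exact (Computable.nat_rec hn (Computable.const [])
    (Computable.cond (heq.comp (Computable.list_length.comp hacc) hi)
      (Computable.option_casesOn (hf.comp Computable.fst hi) hacc
        (Computable.list_concat.comp (hacc.comp Computable.fst) Computable.snd).to₂)
      hacc).to₂).of_eq fun _ => rfl

theorem getElem?_collect (f : ℕ → Option ℕ) (n i v : ℕ) :
    (collect f n)[i]? = some v ↔ i < n ∧ (∀ j < i, (f j).isSome) ∧ f i = some v := by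
  -- A list shorter than the number of rounds has stalled at an undefined value: its length never
  -- equals the round number again.
  have hle : ∀ n, (collect f n).length ≤ n ∧
      ((collect f n).length < n → f (collect f n).length = none) := by
    intro n
    induction n with
    | zero => simp [collect]
    | succ n ih =>
      rw [collect_succ]
      by_cases h : (collect f n).length = n
      · cases h' : f n <;> simp [h, h']
      · have h2 : (collect f n).length < n := lt_of_le_of_ne ih.1 h
        simp only [beq_eq_false_iff_ne.2 h, cond_false]
        exact ⟨by omega, fun _ => ih.2 h2⟩
  have hval : ∀ n i v, (collect f n)[i]? = some v → f i = some v := by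
    intro n
    induction n with
    | zero => simp [collect]
    | succ n ih =>
      intro i v h
      rw [collect_succ] at h
      by_cases h2 : (collect f n).length = n
      · cases h' : f n with
        | none =>
          simp only [h2, h', beq_self_eq_true, cond_true] at h
          exact ih _ _ h
        | some w =>
          simp only [h2, h', beq_self_eq_true, cond_true] at h
          rw [List.getElem?_append] at h
          split_ifs at h with h3
          · exact ih _ _ h
          · have h4 : i = n := by
              by_contra h5
              rw [List.getElem?_eq_none (by simp; omega)] at h
              simp at h
            subst h4
            simp only [h2, Nat.sub_self, List.getElem?_cons_zero, Option.some.injEq] at h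
            rw [h', h]
      · simp only [beq_eq_false_iff_ne.2 h2, cond_false] at h
        exact ih _ _ h
  constructor
  · intro h
    obtain ⟨h1, -⟩ := List.getElem?_eq_some_iff.1 h
    refine ⟨h1.trans_le (hle n).1, fun j hj => ?_, hval _ _ _ h⟩
    rw [hval n j _ (List.getElem?_eq_getElem (hj.trans h1))]
    rfl
  · rintro ⟨h1, h2, h3⟩
    have h4 : i < (collect f n).length := by
      by_contra h4
      have h5 := (hle n).2 (by omega)
      rcases (not_lt.1 h4).lt_or_eq with h6 | h6
      · have := h2 _ h6
        simp [h5] at this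
      · rw [h6, h3] at h5
        simp at h5
    rw [List.getElem?_eq_getElem h4]
    have := hval n i _ (List.getElem?_eq_getElem h4)
    rw [h3] at this
    exact this.symm

end FirstSome

/-! ### Functionals from procedures on strings -/

section Functionals

theorem prefix_of_getElem? {α : Type*} {l l' : List α}
    (h : ∀ (i : ℕ) (v : α), l[i]? = some v → l'[i]? = some v) : l <+: l' := by
  rw [List.prefix_iff_getElem?]
  intro i hi
  exact h i _ (List.getElem?_eq_getElem hi)

theorem getElem?_of_prefix {α : Type*} {l l' : List α} (h : l <+: l') {i : ℕ} {v : α}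
    (hi : l[i]? = some v) : l'[i]? = some v := by
  obtain ⟨h1, h2⟩ := List.getElem?_eq_some_iff.1 hi
  rw [List.prefix_iff_getElem?.1 h i h1, h2]

/-- A functional that outputs, in each place, a value that the procedure `h` finds by reading
initial segments of the input. -/
theorem exists_functional {h : List ℕ → ℕ → Option ℕ} (hh : Computable₂ h) :
    ∃ F : Baire →. Baire, ComputableFunctional F ∧
      ∀ x : Baire, (∀ n, ∃ m v, h (initSeg x m) n = some v) →
        ∃ y ∈ F x, ∀ n, ∃ m, h (initSeg x m) n = some (y n) := by
  -- The answers of `h` on different prefixes may disagree. Keeping the first answer over all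
  -- prefixes makes `H` monotone.
  let H (σ : List ℕ) (n : ℕ) : Option ℕ := firstSome (fun i => h (σ.take i) n) (σ.length + 1)
  let g (σ : List ℕ) : List ℕ := collect (H σ) σ.length
  have hH : Computable₂ H :=
    computable_firstSome
      (f := fun (a : List ℕ × ℕ) i => h (a.1.take i) a.2)
      (hh.comp (Primrec.list_take.to_comp.comp Computable.snd
        (Computable.fst.comp Computable.fst)) (Computable.snd.comp Computable.fst)).to₂
      (Computable.succ.comp (Computable.list_length.comp Computable.fst))
  have hg : Computable g := computable_collect hH Computable.list_length
  have Hmono : ∀ σ τ n v, σ <+: τ → H σ n = some v → H τ n = some v := by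
    intro σ τ n v hst h1
    have h2 : firstSome (fun i => h (τ.take i) n) (σ.length + 1) = some v := by
      rw [← h1]
      refine firstSome_congr fun i hi => ?_
      obtain ⟨ρ, rfl⟩ := hst
      rw [List.take_append_of_le_length (by omega)]
    exact firstSome_mono h2 (by simpa using hst.length_le)
  have gmono : ∀ σ τ : List ℕ, σ <+: τ → g σ <+: g τ := by
    intro σ τ hst
    refine prefix_of_getElem? fun i v hi => ?_
    obtain ⟨h1, h2, h3⟩ := (getElem?_collect _ _ _ _).1 hi
    refine (getElem?_collect _ _ _ _).2 ⟨h1.trans_le hst.length_le, fun j hj => ?_,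
      Hmono _ _ _ _ hst h3⟩
    obtain ⟨w, hw⟩ := Option.isSome_iff_exists.1 (h2 j hj)
    rw [Hmono _ _ _ _ hst hw]
    rfl
  let R (x y : Baire) : Prop := ∀ n, ∃ m, initSeg y n <+: g (initSeg x m)
  have huniq : ∀ x y y', R x y → R x y' → y = y' := by
    intro x y y' hy hy'
    funext n
    obtain ⟨m, hm⟩ := hy (n + 1)
    obtain ⟨m', hm'⟩ := hy' (n + 1)
    have e1 := getElem?_of_prefix (hm.trans (gmono _ _ (initSeg_prefix x (le_max_left m m'))))
      (i := n) (v := y n) (by simp)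
    have e2 := getElem?_of_prefix (hm'.trans (gmono _ _ (initSeg_prefix x (le_max_right m m'))))
      (i := n) (v := y' n) (by simp)
    exact Option.some.inj (e1.symm.trans e2)
  refine ⟨fun x => ⟨∃ y, R x y, fun hy => hy.choose⟩, ⟨g, hg, gmono, fun x y => ?_⟩, ?_⟩
  · constructor
    · rintro ⟨hy, rfl⟩
      exact hy.choose_spec
    · intro hy
      exact ⟨⟨y, hy⟩, huniq _ _ _ (Exists.choose_spec (⟨y, hy⟩ : ∃ y, R x y)) hy⟩
  · intro x hx
    have h1 : ∀ n, ∃ m v, H (initSeg x m) n = some v := by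
      intro n
      obtain ⟨m, v, hv⟩ := hx n
      refine ⟨m, firstSome_isSome (i := m) (v := v) (by simp) ?_⟩
      rw [take_initSeg x le_rfl, hv]
    choose M y hy using h1
    have h2 : R x y := by
      intro n
      -- The summand `n` is needed because `g` outputs at most as many entries as it reads.
      let N := n + (Finset.range n).sup M
      have h3 : ∀ j < n, H (initSeg x N) j = some (y j) := fun j hj =>
        Hmono _ _ _ _ (initSeg_prefix x
          ((Finset.le_sup (f := M) (Finset.mem_range.2 hj)).trans (Nat.le_add_left _ _))) (hy j)
      refine ⟨N, prefix_of_getElem? fun i v hi => ?_⟩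
      rw [getElem?_initSeg] at hi
      split_ifs at hi with hin
      obtain rfl := Option.some.inj hi
      refine (getElem?_collect _ _ _ _).2 ⟨?_, fun j hj => ?_, h3 i hin⟩
      · rw [length_initSeg]
        omega
      · rw [h3 j (hj.trans hin)]
        rfl
    refine ⟨y, ⟨⟨y, h2⟩, huniq _ _ _ (Exists.choose_spec (⟨y, h2⟩ : ∃ y, R x y)) h2⟩, fun n => ?_⟩
    obtain ⟨i, hi, e⟩ := exists_of_firstSome (hy n)
    rw [length_initSeg] at hi
    exact ⟨i, by rw [← e, take_initSeg x (by omega)]⟩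

/-- A monotone function on strings that computes `F`: its outputs are initial segments of the
value of `F`, and they become arbitrarily long. -/
theorem ComputableFunctional.exists_approx {F : Baire →. Baire} (hF : ComputableFunctional F) :
    ∃ g : List ℕ → List ℕ, Computable g ∧ (∀ σ τ : List ℕ, σ <+: τ → g σ <+: g τ) ∧
      ∀ x y, y ∈ F x → (∀ m, g (initSeg x m) = initSeg y (g (initSeg x m)).length) ∧
        ∀ n, ∃ m₀, ∀ m ≥ m₀, n ≤ (g (initSeg x m)).length := by
  obtain ⟨g, hg, gmono, hgF⟩ := hF
  refine ⟨g, hg, gmono, fun x y hy => ⟨fun m => ?_, fun n => ?_⟩⟩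
  · obtain ⟨m', hm'⟩ := (hgF x y).1 hy (g (initSeg x m)).length
    have h1 := hm'.trans (gmono _ _ (initSeg_prefix x (le_max_right m m')))
    have h2 := gmono _ _ (initSeg_prefix x (le_max_left m m'))
    exact (List.prefix_of_prefix_length_le h2 h1 (by simp)).eq_of_length (by simp)
  · obtain ⟨m, hm⟩ := (hgF x y).1 hy n
    refine ⟨m, fun m' h => ?_⟩
    have := (hm.trans (gmono _ _ (initSeg_prefix x h))).length_le
    rwa [length_initSeg] at this

end Functionals

universe u₁ v₁ u₂ v₂ u₃ v₃

/-! ### Approximation of sequences, and transitivity of reducibility -/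

section Convergence

/-- The strings `s 0, s 1, …` are initial segments of `y`, and they become arbitrarily long. -/
def Approximates (s : ℕ → List ℕ) (y : Baire) : Prop :=
  (∀ m, s m = initSeg y (s m).length) ∧ ∀ n, ∃ m₀, ∀ m ≥ m₀, n ≤ (s m).length

theorem approximates_initSeg (x : Baire) : Approximates (initSeg x) x :=
  ⟨fun m => by rw [length_initSeg], fun n => ⟨n, fun m h => by rwa [length_initSeg]⟩⟩

theorem Approximates.getElem? {s : ℕ → List ℕ} {y : Baire} (h : Approximates s y) {m i v : ℕ}
    (hi : (s m)[i]? = some v) : v = y i := by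
  rw [h.1 m, getElem?_initSeg] at hi
  split_ifs at hi
  exact (Option.some.inj hi).symm

theorem Approximates.of_getD {s : ℕ → List ℕ} {y : Baire} {d : ℕ}
    (h : ∀ m, ∀ i < (s m).length, (s m).getD i d = y i)
    (hl : ∀ n, ∃ m₀, ∀ m ≥ m₀, n ≤ (s m).length) : Approximates s y := by
  refine ⟨fun m => List.ext_getElem (by simp) fun i h1 h2 => ?_, hl⟩
  rw [getElem_initSeg, ← h m i h1, List.getD_eq_getElem _ _ h1]

theorem Approximates.getD {s : ℕ → List ℕ} {y : Baire} (h : Approximates s y) {m i : ℕ}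
    (hi : i < (s m).length) (d : ℕ) : (s m).getD i d = y i := by
  rw [List.getD_eq_getElem _ _ hi]
  exact h.getElem? (List.getElem?_eq_getElem hi)

/-- An arbitrary approximation of `x` is allowed as input, not only `initSeg x`; this lets the
string functions of several functionals be chained. -/
theorem ComputableFunctional.exists_approx_comp {F : Baire →. Baire}
    (hF : ComputableFunctional F) : ∃ g : List ℕ → List ℕ, Computable g ∧
      ∀ s x y, Approximates s x → y ∈ F x → Approximates (fun m => g (s m)) y := by
  obtain ⟨g, hg, -, H⟩ := hF.exists_approx
  refine ⟨g, hg, fun s x y hs hy => ?_⟩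
  obtain ⟨h1, h2⟩ := H x y hy
  refine ⟨fun m => ?_, fun n => ?_⟩
  · dsimp only
    rw [hs.1 m]
    exact h1 _
  · obtain ⟨k, hk⟩ := h2 n
    obtain ⟨m₀, hm⟩ := hs.2 k
    exact ⟨m₀, fun m h => by dsimp only; rw [hs.1 m]; exact hk _ (hm m h)⟩

/-- Monotonicity of `G` is not required: it is enough that its outputs are growing pieces of one
sequence. Composing functionals thus reduces to composing functions on strings. -/
theorem exists_functional_of_approximates {G : List ℕ → List ℕ} (hG : Computable G) :
    ∃ F : Baire →. Baire, ComputableFunctional F ∧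
      ∀ x y, Approximates (fun m => G (initSeg x m)) y → y ∈ F x := by
  obtain ⟨F, hF, H⟩ := exists_functional (h := fun σ n => (G σ)[n]?)
    (Computable.list_getElem?.comp (hG.comp Computable.fst) Computable.snd).to₂
  refine ⟨F, hF, fun x y hy => ?_⟩
  obtain ⟨z, hz, hzx⟩ := H x fun n => by
    obtain ⟨m, hm⟩ := hy.2 (n + 1)
    exact ⟨m, _, List.getElem?_eq_getElem (hm m le_rfl)⟩
  obtain rfl : z = y := funext fun n => by
    obtain ⟨m, hm⟩ := hzx n
    exact hy.getElem? hm
  exact hz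

/-- The entries of a string in the even places. -/
def evens (σ : List ℕ) : List ℕ := (List.range ((σ.length + 1) / 2)).map fun i => σ.getD (2 * i) 0

/-- The entries of a string in the odd places. -/
def odds (σ : List ℕ) : List ℕ := (List.range (σ.length / 2)).map fun i => σ.getD (2 * i + 1) 0

/-- The join of two strings. -/
def joinList (σ τ : List ℕ) : List ℕ := (List.range (min (2 * σ.length) (2 * τ.length))).map fun n =>
  if n % 2 = 0 then σ.getD (n / 2) 0 else τ.getD (n / 2) 0

@[simp] theorem length_evens (σ : List ℕ) : (evens σ).length = (σ.length + 1) / 2 := by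
  simp [evens]

@[simp] theorem length_odds (σ : List ℕ) : (odds σ).length = σ.length / 2 := by simp [odds]

@[simp] theorem length_joinList (σ τ : List ℕ) :
    (joinList σ τ).length = min (2 * σ.length) (2 * τ.length) := by simp [joinList]

theorem join_even (p q : Baire) (n : ℕ) : join p q (2 * n) = p n := by
  simp [join]

theorem join_odd (p q : Baire) (n : ℕ) : join p q (2 * n + 1) = q n := by
  have : (2 * n + 1) / 2 = n := by omega
  simp [join, this]

theorem Approximates.evens {s : ℕ → List ℕ} {p q : Baire} (h : Approximates s (join p q)) :
    Approximates (fun m => evens (s m)) p := by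
  refine .of_getD (d := 0) (fun m i hi => ?_) fun n => ?_
  · rw [List.getD_eq_getElem _ _ hi, ← join_even p q]
    rw [length_evens] at hi
    rw [← h.getD (m := m) (by omega) 0]
    simp [Weihrauch.evens]
  · obtain ⟨m₀, hm⟩ := h.2 (2 * n)
    refine ⟨m₀, fun m hmm => ?_⟩
    have := hm m hmm
    rw [length_evens]
    omega

theorem Approximates.odds {s : ℕ → List ℕ} {p q : Baire} (h : Approximates s (join p q)) :
    Approximates (fun m => odds (s m)) q := by
  refine .of_getD (d := 0) (fun m i hi => ?_) fun n => ?_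
  · rw [List.getD_eq_getElem _ _ hi, ← join_odd p q]
    rw [length_odds] at hi
    rw [← h.getD (m := m) (by omega) 0]
    simp [Weihrauch.odds]
  · obtain ⟨m₀, hm⟩ := h.2 (2 * n)
    refine ⟨m₀, fun m hmm => ?_⟩
    have := hm m hmm
    rw [length_odds]
    omega

theorem Approximates.joinList {s t : ℕ → List ℕ} {p q : Baire} (hs : Approximates s p)
    (ht : Approximates t q) : Approximates (fun m => joinList (s m) (t m)) (join p q) := by
  refine .of_getD (d := 0) (fun m i hi => ?_) fun n => ?_
  · rw [List.getD_eq_getElem _ _ hi]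
    rw [length_joinList] at hi
    simp only [Weihrauch.joinList, List.getElem_map, List.getElem_range, join]
    rw [hs.getD (by omega), ht.getD (by omega)]
  · obtain ⟨m₀, hm⟩ := hs.2 n
    obtain ⟨m₁, hm'⟩ := ht.2 n
    refine ⟨max m₀ m₁, fun m hmm => ?_⟩
    have h1 := hm m (le_of_max_le_left hmm)
    have h2 := hm' m (le_of_max_le_right hmm)
    rw [length_joinList]
    omega

theorem primrec_evens : Primrec evens :=
  Primrec.list_map (Primrec.list_range.comp (Primrec.nat_div.comp
    (Primrec.succ.comp Primrec.list_length) (Primrec.const 2)))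
    ((Primrec.list_getD 0).comp Primrec.fst (Primrec.nat_double.comp Primrec.snd)).to₂

theorem primrec_odds : Primrec odds :=
  Primrec.list_map (Primrec.list_range.comp (Primrec.nat_div.comp
    Primrec.list_length (Primrec.const 2)))
    ((Primrec.list_getD 0).comp Primrec.fst (Primrec.nat_double_succ.comp Primrec.snd)).to₂

theorem primrec_joinList : Primrec₂ joinList := by
  have h2 : Primrec fun x : (List ℕ × List ℕ) × ℕ => x.2 / 2 :=
    Primrec.nat_div.comp Primrec.snd (Primrec.const 2)
  exact Primrec.list_map (Primrec.list_range.comp (Primrec.nat_min.comp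
    (Primrec.nat_double.comp (Primrec.list_length.comp Primrec.fst))
    (Primrec.nat_double.comp (Primrec.list_length.comp Primrec.snd))))
    (Primrec.ite (Primrec.eq.comp (Primrec.nat_mod.comp Primrec.snd (Primrec.const 2))
      (Primrec.const 0))
      ((Primrec.list_getD 0).comp (Primrec.fst.comp Primrec.fst) h2)
      ((Primrec.list_getD 0).comp (Primrec.snd.comp Primrec.fst) h2)).to₂

end Convergence

theorem WLE.trans {X₁ : RepSpace.{u₁}} {Y₁ : RepSpace.{v₁}} {X₂ : RepSpace.{u₂}}
    {Y₂ : RepSpace.{v₂}} {X₃ : RepSpace.{u₃}} {Y₃ : RepSpace.{v₃}} {f : Problem X₁ Y₁}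
    {g : Problem X₂ Y₂} {h : Problem X₃ Y₃} (hfg : WLE f g) (hgh : WLE g h) : WLE f h := by
  obtain ⟨Φ₁, Ψ₁, cΦ₁, cΨ₁, H₁⟩ := hfg
  obtain ⟨Φ₂, Ψ₂, cΦ₂, cΨ₂, H₂⟩ := hgh
  obtain ⟨a₁, ca₁, Ha₁⟩ := cΦ₁.exists_approx_comp
  obtain ⟨b₁, cb₁, Hb₁⟩ := cΨ₁.exists_approx_comp
  obtain ⟨a₂, ca₂, Ha₂⟩ := cΦ₂.exists_approx_comp
  obtain ⟨b₂, cb₂, Hb₂⟩ := cΨ₂.exists_approx_comp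
  have ce : Computable evens := primrec_evens.to_comp
  have co : Computable odds := primrec_odds.to_comp
  have cj : Computable₂ joinList := primrec_joinList.to_comp
  obtain ⟨Φ, cΦ, HΦ⟩ := exists_functional_of_approximates (ca₂.comp ca₁)
  -- The backward functional is `Ψ₁(p ⊕ Ψ₂(Φ₁(p) ⊕ r))`; the inner instance `Φ₁(p)` is recomputed
  -- from `p`.
  obtain ⟨Ψ, cΨ, HΨ⟩ := exists_functional_of_approximates
    (G := fun σ => b₁ (joinList (evens σ) (b₂ (joinList (a₁ (evens σ)) (odds σ)))))
    (cb₁.comp (cj.comp ce (cb₂.comp (cj.comp (ca₁.comp ce) co))))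
  refine ⟨Φ, Ψ, cΦ, cΨ, fun p x hp hx => ?_⟩
  obtain ⟨q₁, hq₁, z₁, hz₁, hd₁, K₁⟩ := H₁ p x hp hx
  obtain ⟨q₂, hq₂, z₂, hz₂, hd₂, K₂⟩ := H₂ q₁ z₁ hz₁ hd₁
  refine ⟨q₂, HΦ _ _ (Ha₂ _ _ _ (Ha₁ _ _ _ (approximates_initSeg p) hq₁) hq₂), z₂, hz₂, hd₂,
    fun r y hr hy => ?_⟩
  obtain ⟨s₂, hs₂, y₂, hy₂, hg⟩ := K₂ r y hr hy
  obtain ⟨s₁, hs₁, y₁, hy₁, hf⟩ := K₁ s₂ y₂ hy₂ hg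
  have hi := approximates_initSeg (join p r)
  exact ⟨s₁, HΨ _ _ (Hb₁ _ _ _ (hi.evens.joinList (Hb₂ _ _ _
    ((Ha₁ _ _ _ hi.evens hq₁).joinList hi.odds) hs₂)) hs₁), y₁, hy₁, hf⟩

/-! ### Backward functionals -/

section JoinFunctionals

theorem evens_initSeg_join (p q : Baire) (m : ℕ) :
    evens (initSeg (join p q) m) = initSeg p ((m + 1) / 2) := by
  have := (approximates_initSeg (join p q)).evens.1 m
  rwa [length_evens, length_initSeg] at this

theorem odds_initSeg_join (p q : Baire) (m : ℕ) :
    odds (initSeg (join p q) m) = initSeg q (m / 2) := by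
  have := (approximates_initSeg (join p q)).odds.1 m
  rwa [length_odds, length_initSeg] at this

/-- The two lengths in the conclusion are separate because a prefix of `join p r` of odd length has
one more entry of `p` than of `r`. -/
theorem exists_functional_join {h : List ℕ → List ℕ → ℕ → Option ℕ}
    (hh : Computable fun x : List ℕ × List ℕ × ℕ => h x.1 x.2.1 x.2.2) :
    ∃ F : Baire →. Baire, ComputableFunctional F ∧
      ∀ p r : Baire, (∀ n, ∃ m v, h (initSeg p m) (initSeg r m) n = some v) →
        ∃ y ∈ F (join p r), ∀ n, ∃ a b, h (initSeg p a) (initSeg r b) n = some (y n) := by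
  obtain ⟨F, hF, H⟩ := exists_functional (h := fun σ n => h (evens σ) (odds σ) n)
    (hh.comp ((primrec_evens.to_comp.comp Computable.fst).pair
      ((primrec_odds.to_comp.comp Computable.fst).pair Computable.snd))).to₂
  refine ⟨F, hF, fun p r hpr => ?_⟩
  obtain ⟨y, hy, h1⟩ := H (join p r) fun n => by
    obtain ⟨m, v, hv⟩ := hpr n
    refine ⟨2 * m, v, ?_⟩
    rw [evens_initSeg_join, odds_initSeg_join, show (2 * m + 1) / 2 = m by omega,
      show 2 * m / 2 = m by omega, hv]
  refine ⟨y, hy, fun n => ?_⟩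
  obtain ⟨m, hm⟩ := h1 n
  rw [evens_initSeg_join, odds_initSeg_join] at hm
  exact ⟨_, _, hm⟩

/-- Only position `0` needs a search; all others hold `0`, as names in `natRep` demand. -/
theorem exists_functional_join_nat {h : List ℕ → List ℕ → Option ℕ} (hh : Computable₂ h) :
    ∃ F : Baire →. Baire, ComputableFunctional F ∧
      ∀ p r : Baire, (∃ m v, h (initSeg p m) (initSeg r m) = some v) →
        ∃ s ∈ F (join p r), ∃ (a b : ℕ) (v : natRep), h (initSeg p a) (initSeg r b) = some v ∧
          natRep.IsName s v := by
  obtain ⟨F, hF, H⟩ := exists_functional_join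
    (h := fun σ τ n => n.casesOn (h σ τ) fun _ => some 0)
    (Computable.nat_casesOn (Computable.snd.comp Computable.snd)
      (hh.comp Computable.fst (Computable.fst.comp Computable.snd))
      (Computable.const (some 0)).to₂)
  refine ⟨F, hF, fun p r ⟨m, v, hv⟩ => ?_⟩
  obtain ⟨s, hs, hsn⟩ := H p r fun n => by
    cases n with
    | zero => exact ⟨m, v, hv⟩
    | succ n => exact ⟨0, 0, rfl⟩
  obtain ⟨a, b, hab⟩ := hsn 0
  refine ⟨s, hs, a, b, s 0, hab, rfl, fun n hn => ?_⟩
  obtain ⟨n, rfl⟩ := Nat.exists_eq_succ_of_ne_zero hn.ne'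
  obtain ⟨a, b, hab⟩ := hsn (n + 1)
  exact (Option.some.inj hab).symm

end JoinFunctionals

/-! ### The equivalence of `Min` and `LPO^*` -/

theorem eq_zero_or_one_of_mem_lpo {p : Baire} {y : ℕ} (h : y ∈ LPO p) : y = 0 ∨ y = 1 := by
  simp only [LPO] at h
  split_ifs at h
  · exact Or.inl h
  · exact Or.inr h

theorem eq_one_iff_of_mem_lpo {p : Baire} {y : ℕ} (h : y ∈ LPO p) : y = 1 ↔ ∀ n, p n ≠ 0 := by
  simp only [LPO] at h
  split_ifs at h with h1
  · obtain rfl : y = 0 := h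
    simpa using h1
  · obtain rfl : y = 1 := h
    simpa using h1

theorem mem_dom_star_lpo (a : starRep baireRep) : a ∈ dom (star LPO) := by
  have h : ∀ p : Baire, ∃ y, y ∈ LPO p := fun p => ⟨_, rfl⟩
  choose y hy using h
  exact ⟨⟨a.1, fun j => y (a.2 j)⟩, _, rfl, fun j => hy _⟩

/-- For each `j < p 0` one asks whether all terms exceed `j`, that is, whether `p m - j` is never
zero. The minimum is at most `p 0`, so these questions suffice: a term `v ≤ p 0` is minimal if `v =
0` or the answer for `v - 1` is positive. -/
theorem min_wle_star_lpo : WLE Min (star LPO) := by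
  obtain ⟨Φ, cΦ, HΦ⟩ := exists_functional
    -- At `n = 0` truncated subtraction gives the pair `(0, 0)`, so the entry is `p 0`, which is
    -- also the required number of questions.
    (h := fun σ n => (σ[(n - 1).unpair.2]?).map fun v => v - (n - 1).unpair.1) (by
      have hu : Primrec fun x : List ℕ × ℕ => (x.2 - 1).unpair :=
        Primrec.unpair.comp (Primrec.pred.comp Primrec.snd)
      exact (Primrec.option_map (Primrec.list_getElem?.comp Primrec.fst (Primrec.snd.comp hu))
        (Primrec.nat_sub.comp Primrec.snd
          (Primrec.fst.comp (hu.comp Primrec.fst))).to₂).to_comp)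
  -- An answer that has not been read counts as `0`, so no positive `v` is accepted too early. The
  -- bound by `p 0` ensures that question `v - 1` was asked.
  let c (σ τ : List ℕ) (v : ℕ) : Prop :=
    v ≤ σ.getD 0 0 ∧ (v = 0 ∨ τ.getD (Nat.pair (v - 1) 0 + 1) 0 = 1)
  let h (σ τ : List ℕ) : Option ℕ := firstSome
    (fun i => (σ[i]?).bind fun v => if c σ τ v then some v else none) σ.length
  obtain ⟨Ψ, cΨ, HΨ⟩ := exists_functional_join_nat (h := h) (by
    refine computable_firstSome (Primrec.to_comp ?_) (Computable.list_length.comp Computable.fst)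
    have hv : Primrec fun x : ((List ℕ × List ℕ) × ℕ) × ℕ => x.2 := Primrec.snd
    have hσ : Primrec fun x : ((List ℕ × List ℕ) × ℕ) × ℕ => x.1.1.1 :=
      Primrec.fst.comp (Primrec.fst.comp Primrec.fst)
    have hτ : Primrec fun x : ((List ℕ × List ℕ) × ℕ) × ℕ => x.1.1.2 :=
      Primrec.snd.comp (Primrec.fst.comp Primrec.fst)
    refine Primrec.option_bind
      (Primrec.list_getElem?.comp (Primrec.fst.comp Primrec.fst) Primrec.snd)
      (Primrec.ite (PrimrecPred.and
        (Primrec.nat_le.comp hv ((Primrec.list_getD 0).comp hσ (Primrec.const 0)))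
        (PrimrecPred.or (Primrec.eq.comp hv (Primrec.const 0))
          (Primrec.eq.comp ((Primrec.list_getD 0).comp hτ (Primrec.succ.comp
            (Primrec₂.natPair.comp (Primrec.pred.comp hv) (Primrec.const 0))))
            (Primrec.const 1))))
        (Primrec.option_some.comp hv) (Primrec.const none)).to₂)
  refine ⟨Φ, Ψ, cΦ, cΨ, ?_⟩
  rintro p x rfl -
  obtain ⟨q, hq, hqn⟩ := HΦ p fun n => by
    exact ⟨(n - 1).unpair.2 + 1, p (n - 1).unpair.2 - (n - 1).unpair.1, by simp⟩
  have hq' : ∀ n, q n = p (n - 1).unpair.2 - (n - 1).unpair.1 := by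
    intro n
    obtain ⟨m, hm⟩ := hqn n
    rw [getElem?_initSeg] at hm
    split_ifs at hm
    · exact (Option.some.inj hm).symm
    · simp at hm
  refine ⟨q, hq, ⟨p 0, fun j m => p m - j⟩, ⟨by simp [hq'], fun j => ?_⟩, ?_, ?_⟩
  · funext m
    simp [hq']
  · exact mem_dom_star_lpo _
  · rintro r _ hr ⟨y, rfl, hy⟩
    obtain ⟨hr0, hrj⟩ := hr
    have hbit : ∀ v, v < p 0 → (r (Nat.pair v 0 + 1) = 1 ↔ ∀ n, v < p n) := by
      intro v hv
      have h1 := (hrj ⟨v, hv⟩).1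
      dsimp only at h1
      rw [h1, eq_one_iff_of_mem_lpo (hy ⟨v, hv⟩)]
      exact forall_congr' fun n => by dsimp only; omega
    obtain ⟨n₀, hn₀⟩ : ∃ n₀, ∀ n, p n₀ ≤ p n := by
      obtain ⟨v, ⟨n₀, rfl⟩, hv⟩ := WellFounded.has_min (wellFounded_lt (α := ℕ)) (Set.range p)
        ⟨_, 0, rfl⟩
      exact ⟨n₀, fun n => not_lt.1 (hv _ ⟨n, rfl⟩)⟩
    -- This prefix contains both the minimal term and the answer for `p n₀ - 1`.
    obtain ⟨s, hs, a, b, v, hv, hsv⟩ := HΨ p r ⟨n₀ + Nat.pair (p n₀ - 1) 0 + 2, by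
      refine firstSome_isSome (i := n₀) (v := p n₀) (by rw [length_initSeg]; omega) ?_
      rw [getElem?_initSeg, if_pos (by omega), Option.bind_some, if_pos]
      refine ⟨by rw [getD_initSeg (by omega)]; exact hn₀ 0, ?_⟩
      rcases Nat.eq_zero_or_pos (p n₀) with h0 | h0
      · exact Or.inl h0
      · right
        rw [getD_initSeg (by omega), hbit _ (by have := hn₀ 0; omega)]
        intro n
        have := hn₀ n
        omega⟩
    refine ⟨s, hs, v, hsv, ?_⟩
    obtain ⟨i, hi, hiv⟩ := exists_of_firstSome hv
    rw [length_initSeg] at hi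
    rw [getElem?_initSeg, if_pos hi, Option.bind_some] at hiv
    split_ifs at hiv with hc
    obtain rfl : p i = v := Option.some.inj hiv
    refine ⟨⟨i, rfl⟩, ?_⟩
    rintro _ ⟨n, rfl⟩
    obtain ⟨h1, h2 | h2⟩ := hc
    · omega
    · by_cases hb : Nat.pair (p i - 1) 0 + 1 < b
      · rw [getD_initSeg (by omega)] at h1
        rw [getD_initSeg hb] at h2
        by_contra h3
        have := (hbit (p i - 1) (by omega)).1 h2 n
        omega
      · rw [List.getD_eq_default _ _ (by rw [length_initSeg]; omega)] at h2
        simp at h2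

section BoundedQuantifiers

theorem primrecPred_forall_lt {α : Type*} [Primcodable α] {R : α → ℕ → Prop} {n : α → ℕ}
    (hR : PrimrecRel R) (hn : Primrec n) : PrimrecPred fun a => ∀ i < n a, R a i :=
  ((PrimrecRel.forall_mem_list (R := fun (i : ℕ) (a : α) => R a i)
    (hR.comp Primrec.snd Primrec.fst)).comp (Primrec.list_range.comp hn) Primrec.id).of_eq
    fun a => by simp

theorem primrecPred_exists_lt {α : Type*} [Primcodable α] {R : α → ℕ → Prop} {n : α → ℕ}
    (hR : PrimrecRel R) (hn : Primrec n) : PrimrecPred fun a => ∃ i < n a, R a i :=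
  ((PrimrecRel.exists_mem_list (R := fun (i : ℕ) (a : α) => R a i)
    (hR.comp Primrec.snd Primrec.fst)).comp (Primrec.list_range.comp hn) Primrec.id).of_eq
    fun a => by simp

end BoundedQuantifiers

section LPOMin

/-- The `j`-th of the sequences coded in `σ` has no zero among its first `n` entries. -/
abbrev NoZero (σ : List ℕ) (n j : ℕ) : Prop := ∀ m < n, σ.getD (Nat.pair j m + 1) 1 ≠ 0

/-- Those of the sequences coded in `σ` that have no zero among their first `n` entries. -/
def noZeros (σ : List ℕ) (n : ℕ) : List ℕ := (List.range (σ.getD 0 0)).filter (NoZero σ n ·)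

/-- The string `σ` is so long that it has the first `n` entries of all sequences coded in it. -/
abbrev LongEnough (σ : List ℕ) (n : ℕ) : Prop := Nat.pair (σ.getD 0 0) n + 1 < σ.length

theorem primrec_noZero : PrimrecPred fun x : (List ℕ × ℕ) × ℕ => NoZero x.1.1 x.1.2 x.2 := by
  have hj : Primrec fun x : ((List ℕ × ℕ) × ℕ) × ℕ => x.1.2 := Primrec.snd.comp Primrec.fst
  have hσ : Primrec fun x : ((List ℕ × ℕ) × ℕ) × ℕ => x.1.1.1 :=
    Primrec.fst.comp (Primrec.fst.comp Primrec.fst)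
  exact primrecPred_forall_lt (R := fun (x : (List ℕ × ℕ) × ℕ) m => x.1.1.getD (Nat.pair x.2 m + 1) 1 ≠ 0)
    (PrimrecPred.not (Primrec.eq.comp ((Primrec.list_getD 1).comp hσ
      (Primrec.succ.comp (Primrec₂.natPair.comp hj Primrec.snd))) (Primrec.const 0)))
    (Primrec.snd.comp Primrec.fst)

theorem primrec_noZeros : Primrec₂ noZeros := by
  have h : PrimrecRel fun (j : ℕ) (x : List ℕ × ℕ) => NoZero x.1 x.2 j :=
    primrec_noZero.comp (Primrec.snd.pair Primrec.fst)
  exact (h.listFilter.comp (Primrec.list_range.comp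
    ((Primrec.list_getD 0).comp Primrec.fst (Primrec.const 0))) Primrec.id).to₂

theorem primrec_longEnough : PrimrecRel LongEnough :=
  Primrec.nat_lt.comp (Primrec.succ.comp (Primrec₂.natPair.comp
    ((Primrec.list_getD 0).comp Primrec.fst (Primrec.const 0)) Primrec.snd))
    (Primrec.list_length.comp Primrec.fst)

theorem noZero_initSeg_iff {p : Baire} {a n j : ℕ} (h : LongEnough (initSeg p a) n)
    (hj : j < p 0) : NoZero (initSeg p a) n j ↔ ∀ m < n, p (Nat.pair j m + 1) ≠ 0 := by
  rw [LongEnough, length_initSeg] at h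
  rw [getD_initSeg (by omega)] at h
  refine forall₂_congr fun m hm => ?_
  rw [getD_initSeg]
  have := (Nat.pair_lt_pair_left m hj).trans (Nat.pair_lt_pair_right (p 0) hm)
  omega

theorem noZeros_initSeg {p : Baire} {a n : ℕ} (h : LongEnough (initSeg p a) n) :
    noZeros (initSeg p a) n =
      (List.range (p 0)).filter (fun j => ∀ m < n, p (Nat.pair j m + 1) ≠ 0) := by
  have h0 : (initSeg p a).getD 0 0 = p 0 := getD_initSeg (by
    rw [LongEnough, length_initSeg] at h; omega) 0
  rw [noZeros, h0]
  refine List.filter_congr fun j hj => ?_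
  rw [decide_eq_decide]
  exact noZero_initSeg_iff h (List.mem_range.1 hj)

theorem longEnough_initSeg {p : Baire} {a n : ℕ} (h : Nat.pair (p 0) n + 1 < a) :
    LongEnough (initSeg p a) n := by
  rw [LongEnough, length_initSeg, getD_initSeg (by omega)]
  exact h

/-- The number of sequences without a zero among their first `n` entries does not increase with `n`.
At a stage where it is minimal, no surviving sequence can acquire a zero later, so this stage
answers all questions. -/
theorem star_lpo_wle_min : WLE (star LPO) Min := by
  obtain ⟨Φ, cΦ, HΦ⟩ := exists_functional
    (h := fun σ n => if LongEnough σ n then some (noZeros σ n).length else none)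
    (Primrec.ite primrec_longEnough (Primrec.option_some.comp
      (Primrec.list_length.comp primrec_noZeros)) (Primrec.const none)).to_comp
  let out (σ : List ℕ) (n t : ℕ) : ℕ := if t = 0 then σ.getD 0 0 else
    if (t - 1).unpair.2 = 0 ∧ NoZero σ n (t - 1).unpair.1 then 1 else 0
  obtain ⟨Ψ, cΨ, HΨ⟩ := exists_functional_join
    (h := fun σ τ t => firstSome (fun n =>
      if LongEnough σ n ∧ τ[0]? = some (noZeros σ n).length then some (out σ n t) else none)
      σ.length) (by
    refine computable_firstSome (Primrec.to_comp ?_) (Computable.list_length.comp Computable.fst)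
    have hσ : Primrec fun x : (List ℕ × List ℕ × ℕ) × ℕ => x.1.1 :=
      Primrec.fst.comp Primrec.fst
    have hτ : Primrec fun x : (List ℕ × List ℕ × ℕ) × ℕ => x.1.2.1 :=
      Primrec.fst.comp (Primrec.snd.comp Primrec.fst)
    have ht : Primrec fun x : (List ℕ × List ℕ × ℕ) × ℕ => x.1.2.2 :=
      Primrec.snd.comp (Primrec.snd.comp Primrec.fst)
    have hn : Primrec fun x : (List ℕ × List ℕ × ℕ) × ℕ => x.2 := Primrec.snd
    have hu : Primrec fun x : (List ℕ × List ℕ × ℕ) × ℕ => (x.1.2.2 - 1).unpair :=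
      Primrec.unpair.comp (Primrec.pred.comp ht)
    refine Primrec.ite ((primrec_longEnough.comp hσ hn).and (Primrec.eq.comp
      (Primrec.list_getElem?.comp hτ (Primrec.const 0)) (Primrec.option_some.comp
        (Primrec.list_length.comp (primrec_noZeros.comp hσ hn)))))
      (Primrec.option_some.comp (Primrec.ite (Primrec.eq.comp ht (Primrec.const 0))
        ((Primrec.list_getD 0).comp hσ (Primrec.const 0))
        (Primrec.ite (PrimrecPred.and
          (Primrec.eq.comp (Primrec.snd.comp hu) (Primrec.const 0))
          (primrec_noZero.comp ((hσ.pair hn).pair (Primrec.fst.comp hu))))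
          (Primrec.const 1) (Primrec.const 0)))) (Primrec.const none))
  refine ⟨Φ, Ψ, cΦ, cΨ, ?_⟩
  rintro p ⟨k, x⟩ ⟨rfl : p 0 = k, hx⟩ -
  have hx' : ∀ j m, x j m = p (Nat.pair j m + 1) := fun j m => (congrFun (hx j) m).symm
  let N (n : ℕ) : List ℕ :=
    (List.range (p 0)).filter (fun j => ∀ m < n, p (Nat.pair j m + 1) ≠ 0)
  obtain ⟨q, hq, hqn⟩ := HΦ p fun n =>
    ⟨Nat.pair (p 0) n + 2, _, if_pos (longEnough_initSeg (by omega))⟩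
  have hq' : ∀ n, q n = (N n).length := by
    intro n
    obtain ⟨m, hm⟩ := hqn n
    split_ifs at hm with h1
    rw [noZeros_initSeg h1] at hm
    exact (Option.some.inj hm).symm
  refine ⟨q, hq, q, rfl, ?_, ?_⟩
  · obtain ⟨v, hv, hv'⟩ := WellFounded.has_min (wellFounded_lt (α := ℕ)) (Set.range q)
      ⟨_, 0, rfl⟩
    exact ⟨v, hv, fun w hw => not_lt.1 (hv' w hw)⟩
  · rintro r v ⟨hr : r 0 = v, -⟩ ⟨⟨n₀, hn₀⟩, hmin⟩
    obtain ⟨s, hs, hst⟩ := HΨ p r fun t => by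
      have h1 : LongEnough (initSeg p (Nat.pair (p 0) n₀ + 2)) n₀ :=
        longEnough_initSeg (by omega)
      refine ⟨Nat.pair (p 0) n₀ + 2, firstSome_isSome (i := n₀) ?_ (if_pos ⟨h1, ?_⟩)⟩
      · rw [length_initSeg]
        have := Nat.right_le_pair (p 0) n₀
        omega
      · rw [noZeros_initSeg h1, getElem?_initSeg, if_pos (by omega), hr, ← hn₀, hq']
    -- Different output positions may use different stages `n`. All of them have the minimal count,
    -- hence give the same answers.
    have key : ∀ t, ∃ n a, LongEnough (initSeg p a) n ∧ s t = out (initSeg p a) n t ∧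
        ∀ j < p 0, (NoZero (initSeg p a) n j ↔ ∀ m, p (Nat.pair j m + 1) ≠ 0) := by
      intro t
      obtain ⟨a, b, hab⟩ := hst t
      obtain ⟨n, -, hn⟩ := exists_of_firstSome hab
      split_ifs at hn with h1
      obtain ⟨h1, h2⟩ := h1
      refine ⟨n, a, h1, (Option.some.inj hn).symm, fun j hj => ?_⟩
      rw [noZero_initSeg_iff h1 hj]
      refine ⟨fun h3 m => ?_, fun h3 m _ => h3 m⟩
      rw [noZeros_initSeg h1, getElem?_initSeg] at h2
      split_ifs at h2
      have h4 : (N n).length = v := (Option.some.inj h2).symm.trans hr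
      -- The later list is a sublist of the earlier one and, by minimality of the count, is not
      -- shorter.
      have h5 : N (max n (m + 1)) = N n := by
        refine (List.monotone_filter_right _ fun j hj => ?_).eq_of_length_le ?_
        · simp only [decide_eq_true_eq] at hj ⊢
          exact fun m hm => hj m (hm.trans_le (le_max_left _ _))
        · rw [h4, ← hq']
          exact hmin ⟨_, rfl⟩
      have h6 : j ∈ N (max n (m + 1)) := by
        rw [h5]
        exact List.mem_filter.2 ⟨List.mem_range.2 hj, by simpa using h3⟩
      have h7 := (List.mem_filter.1 h6).2
      simp only [decide_eq_true_eq] at h7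
      exact h7 m (lt_of_lt_of_le m.lt_succ_self (le_max_right _ _))
    obtain ⟨⟨k', y⟩, hy⟩ := mem_dom_star_lpo ⟨p 0, x⟩
    obtain ⟨y, e, hy⟩ := id hy
    refine ⟨s, hs, ⟨p 0, y⟩, ⟨?_, fun j => ⟨?_, fun m hm => ?_⟩⟩, ⟨y, rfl, hy⟩⟩
    · obtain ⟨n, a, h1, h2, -⟩ := key 0
      rw [LongEnough, length_initSeg] at h1
      simp only [out, if_true] at h2
      rw [h2, getD_initSeg (by omega)]
    · obtain ⟨n, a, h1, h2, h3⟩ := key (Nat.pair j 0 + 1)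
      simp only [out, Nat.add_one_ne_zero, if_false, Nat.add_sub_cancel, Nat.unpair_pair, true_and,
        h3 j j.2] at h2
      have h4 := eq_one_iff_of_mem_lpo (hy j)
      have h5 := eq_zero_or_one_of_mem_lpo (hy j)
      dsimp only at h4 h5
      simp only [hx'] at h4
      dsimp only
      rw [h2]
      split_ifs with h6
      · exact (h4.2 (by simpa [h3 j j.2] using h6)).symm
      · rcases h5 with h5 | h5
        · exact h5.symm
        · exact absurd (by simpa [h3 j j.2] using h4.1 h5) h6
    · obtain ⟨n, a, -, h2, -⟩ := key (Nat.pair j m + 1)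
      simpa [out, hm.ne'] using h2

end LPOMin

/-! ### Iterated finite condensations -/

section FinClass

variable {L M : Type*} [LinearOrder L] [LinearOrder M]

/-- The iterated finite condensations of a linear order: two points are equivalent at level `n + 1`
if the interval between them meets only finitely many classes of level `n`. -/
def FinClass {L : Type*} [LinearOrder L] : ℕ → L → L → Prop
  | 0, x, y => x = y
  | n + 1, x, y => ∃ F : Set L, F.Finite ∧ ∀ z ∈ Set.uIcc x y, ∃ f ∈ F, FinClass n z f

theorem FinClass.map (e : L ≃o M) {n : ℕ} {x y : L} (h : FinClass n x y) :
    FinClass n (e x) (e y) := by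
  induction n generalizing x y with
  | zero => exact congrArg e h
  | succ n ih =>
    obtain ⟨F, hF, H⟩ := h
    refine ⟨e '' F, hF.image e, fun z hz => ?_⟩
    obtain ⟨z, rfl⟩ := e.surjective z
    have hz' : z ∈ Set.uIcc x y := by
      simpa [Set.mem_uIcc] using hz
    obtain ⟨f, hf, hzf⟩ := H z hz'
    exact ⟨e f, Set.mem_image_of_mem e hf, ih hzf⟩

theorem finClass_map_iff (e : L ≃o M) {n : ℕ} {x y : L} :
    FinClass n (e x) (e y) ↔ FinClass n x y :=
  ⟨fun h => by simpa using h.map e.symm, FinClass.map e⟩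

end FinClass

/-! ### Condensations of `ℤ^I` -/

section ZPow

variable {I : Type*} [LinearOrder I]

theorem zpow_lt_iff {x y : ZPow I} : x < y ↔
    ∃ i, (∀ j, i < j → ofColex x j = ofColex y j) ∧ ofColex x i < ofColex y i :=
  Finsupp.Colex.lt_iff

/-- If `z` differed from `x` above `t`, then at the greatest such index `z` would exceed `x`, hence
also `y`, which agrees with `x` there. -/
theorem zpow_le_between {x y z : ZPow I} {t : I} (hxz : x ≤ z) (hzy : z ≤ y)
    (h : ∀ j, t < j → ofColex x j = ofColex y j) :
    (∀ j, t < j → ofColex z j = ofColex x j) ∧ ofColex x t ≤ ofColex z t ∧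
      ofColex z t ≤ ofColex y t := by
  have key : ∀ j, t < j → ofColex z j = ofColex x j := by
    by_contra! hne
    obtain ⟨j, htj, hj⟩ := hne
    rcases hxz.eq_or_lt with rfl | hlt
    · exact hj rfl
    obtain ⟨i, hi, hxi⟩ := zpow_lt_iff.1 hlt
    have hti : t < i := by
      by_contra hti
      exact hj (hi j ((not_lt.1 hti).trans_lt htj)).symm
    refine hzy.not_gt (zpow_lt_iff.2 ⟨i, fun k hk => ?_, ?_⟩)
    · rw [← h k (hti.trans hk), hi k hk]
    · rwa [← h i hti]
  refine ⟨key, ?_, ?_⟩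
  · by_contra hlt
    exact hxz.not_gt (zpow_lt_iff.2 ⟨t, key, not_le.1 hlt⟩)
  · by_contra hlt
    exact hzy.not_gt (zpow_lt_iff.2 ⟨t, fun j hj => by rw [key j hj, h j hj], not_le.1 hlt⟩)

/-- Adding natural multiples of the unit at `t` to `x` stays inside the interval, since `x < y` is
decided at the higher index `i`. These points differ at `t ∉ S`, so each needs its own
representative. -/
theorem infinite_classes {x y : ZPow I} {i t : I} {S : Finset I}
    (hi : ∀ j, i < j → ofColex x j = ofColex y j) (hxy : ofColex x i < ofColex y i) (ht : t < i)
    (htS : t ∉ S) {F : Set (ZPow I)}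
    (hF : ∀ z ∈ Set.Icc x y, ∃ f ∈ F, ∀ j ∉ S, ofColex z j = ofColex f j) : ¬ F.Finite := by
  let z (c : ℕ) : ZPow I := toColex (ofColex x + Finsupp.single t (c : ℤ))
  have hzt : ∀ c, ofColex (z c) t = ofColex x t + c := fun c => by simp [z]
  have hzj : ∀ c j, j ≠ t → ofColex (z c) j = ofColex x j := fun c j hj => by
    simp [z, hj.symm]
  have hz : ∀ c, z c ∈ Set.Icc x y := by
    intro c
    constructor
    · rcases Nat.eq_zero_or_pos c with rfl | hc
      · simp [z]
      · refine (zpow_lt_iff.2 ⟨t, fun j hj => (hzj c j hj.ne').symm, ?_⟩).le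
        rw [hzt]
        omega
    · refine (zpow_lt_iff.2 ⟨i, fun j hj => ?_, ?_⟩).le
      · rw [hzj c j (ht.trans hj).ne', hi j hj]
      · rwa [hzj c i ht.ne']
  choose f hf hzf using fun c => hF (z c) (hz c)
  refine Set.infinite_of_injective_forall_mem (f := f) (fun c d hcd => ?_) hf
  have h1 := hzf c t htS
  rw [hcd, ← hzf d t htS, hzt, hzt] at h1
  omega

/-- If `x` and `y` differed at `i`, their greatest difference would lie above `t`, and
`infinite_classes` would apply. So the next condensation can forget a coordinate outside `S` only if
no index outside `S` lies below it. -/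
theorem eq_of_finClass_succ {S : Finset I} {n : ℕ}
    (hS : ∀ x y : ZPow I, FinClass n x y ↔ ∀ i ∉ S, ofColex x i = ofColex y i)
    {x y : ZPow I} (h : FinClass (n + 1) x y) {t i : I} (ht : t ∉ S) (hti : t < i) :
    ofColex x i = ofColex y i := by
  obtain ⟨F, hF, H⟩ := h
  simp only [hS] at H
  by_contra hne
  have hxy : x ≠ y := by
    rintro rfl
    exact hne rfl
  rcases lt_or_gt_of_ne hxy with hlt | hlt
  · obtain ⟨j, hj, hj'⟩ := zpow_lt_iff.1 hlt
    have hij : i ≤ j := by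
      by_contra hij
      exact hne (hj i (not_le.1 hij))
    exact infinite_classes hj hj' (hti.trans_le hij) ht
      (fun z hz => H z (Set.Icc_subset_uIcc hz)) hF
  · obtain ⟨j, hj, hj'⟩ := zpow_lt_iff.1 hlt
    have hij : i ≤ j := by
      by_contra hij
      exact hne (hj i (not_le.1 hij)).symm
    exact infinite_classes hj hj' (hti.trans_le hij) ht
      (fun z hz => H z (Set.Icc_subset_uIcc' hz)) hF

theorem exists_greatest_of_isLowerSet {S : Finset I} {n : ℕ} (hS : IsLowerSet (S : Set I))
    (hn : S.card = n + 1) : ∃ t ∈ S, (∀ i, i ∉ S ↔ t < i) ∧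
      IsLowerSet (S.erase t : Set I) ∧ (S.erase t).card = n := by
  have hne : S.Nonempty := Finset.card_pos.1 (by omega)
  refine ⟨S.max' hne, S.max'_mem hne, fun i => ⟨fun hi => ?_, fun hi hiS => ?_⟩, ?_, ?_⟩
  · by_contra hlt
    exact hi (hS (not_lt.1 hlt) (S.max'_mem hne))
  · exact hi.not_ge (S.le_max' i hiS)
  · intro a b hba ha
    simp only [Finset.coe_erase, Set.mem_sdiff, Finset.mem_coe, Set.mem_singleton_iff] at ha ⊢
    refine ⟨hS hba ha.1, ?_⟩
    rintro rfl
    exact ha.2 (le_antisymm (S.le_max' a ha.1) hba)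
  · rw [Finset.card_erase_of_mem (S.max'_mem hne), hn]
    rfl

/-- Induction that removes the greatest index `t` of `S`. Between points that agree above `t` only
the finitely many values of the `t`-th coordinate matter modulo the lower indices; conversely,
`eq_of_finClass_succ` rules out differences above `t`. -/
theorem finClass_zpow_iff {n : ℕ} {S : Finset I} (hS : IsLowerSet (S : Set I)) (hn : S.card = n)
    (x y : ZPow I) : FinClass n x y ↔ ∀ i ∉ S, ofColex x i = ofColex y i := by
  classical
  induction n generalizing S x y with
  | zero =>
    obtain rfl := Finset.card_eq_zero.1 hn
    simp only [FinClass, Finset.notMem_empty, not_false_eq_true, forall_true_left]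
    exact ⟨fun h i => by rw [h], fun h => ofColex.injective (Finsupp.ext h)⟩
  | succ n ih =>
    obtain ⟨t, htS, ht, hS', hn'⟩ := exists_greatest_of_isLowerSet hS hn
    have ih' := ih hS' hn'
    refine ⟨fun h i hi => eq_of_finClass_succ ih' h (t := t) (by simp) ((ht i).1 hi), fun h => ?_⟩
    -- The representatives are `x` with its `t`-th coordinate replaced by the integers between those
    -- of `x` and `y`.
    refine ⟨(fun c => toColex ((ofColex x).update t c)) ''
      Set.uIcc (ofColex x t) (ofColex y t), (Set.finite_Icc _ _).image _, fun z hz => ?_⟩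
    have h' : ∀ j, t < j → ofColex x j = ofColex y j := fun j hj => h j ((ht j).2 hj)
    have hz' : (∀ j, t < j → ofColex z j = ofColex x j) ∧
        ofColex z t ∈ Set.uIcc (ofColex x t) (ofColex y t) := by
      rcases Set.mem_uIcc.1 hz with ⟨h1, h2⟩ | ⟨h1, h2⟩
      · obtain ⟨k1, k2, k3⟩ := zpow_le_between h1 h2 h'
        exact ⟨k1, Set.mem_uIcc.2 (Or.inl ⟨k2, k3⟩)⟩
      · obtain ⟨k1, k2, k3⟩ := zpow_le_between h1 h2 fun j hj => (h' j hj).symm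
        exact ⟨fun j hj => (k1 j hj).trans (h' j hj).symm, Set.mem_uIcc.2 (Or.inr ⟨k2, k3⟩)⟩
    refine ⟨_, ⟨_, hz'.2, rfl⟩, (ih' _ _).2 fun j hj => ?_⟩
    by_cases hjt : j = t
    · subst hjt
      simp
    · have hjS : j ∉ S := fun hjS => hj (Finset.mem_erase.2 ⟨hjt, hjS⟩)
      simpa [Function.update_of_ne hjt] using hz'.1 j ((ht j).1 hjS)

theorem finClass_zpow_stable {n : ℕ} {S : Finset I} (hS : IsLowerSet (S : Set I))
    (hn : S.card = n) (h : ∀ i ∉ S, ∃ t ∉ S, t < i) {x y : ZPow I} (hxy : FinClass (n + 1) x y) :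
    FinClass n x y := by
  refine (finClass_zpow_iff hS hn x y).2 fun i hi => ?_
  obtain ⟨t, ht, hti⟩ := h i hi
  exact eq_of_finClass_succ (finClass_zpow_iff hS hn) hxy ht hti

theorem exists_finClass_zpow {n : ℕ} {S : Finset I} (hS : IsLowerSet (S : Set I))
    (hn : S.card = n + 1) : ∃ x y : ZPow I, FinClass (n + 1) x y ∧ ¬ FinClass n x y := by
  obtain ⟨t, htS, ht, hS', hn'⟩ := exists_greatest_of_isLowerSet hS hn
  refine ⟨0, toColex (Finsupp.single t 1), ?_, ?_⟩
  · rw [finClass_zpow_iff hS hn]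
    intro i hi
    have : t ≠ i := ((ht i).1 hi).ne
    simp [this]
  · rw [finClass_zpow_iff hS' hn']
    intro h
    have := h t (by simp)
    simp at this

theorem exists_isLowerSet_card {S : Finset I} (hS : IsLowerSet (S : Set I)) {k : ℕ}
    (hk : k ≤ S.card) : ∃ T : Finset I, IsLowerSet (T : Set I) ∧ T.card = k := by
  obtain ⟨d, hd⟩ := Nat.exists_eq_add_of_le hk
  induction d generalizing k with
  | zero => exact ⟨S, hS, hd⟩
  | succ d ih =>
    obtain ⟨T, hT, hk⟩ := ih (k := k + 1) (by omega) (by omega)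
    obtain ⟨t, -, -, h1, h2⟩ := exists_greatest_of_isLowerSet hT hk
    exact ⟨_, h1, h2⟩

theorem exists_isLowerSet_of_initialSeg {n : ℕ}
    (f : InitialSeg ((· < ·) : Fin n → Fin n → Prop) ((· < ·) : I → I → Prop)) :
    ∃ T : Finset I, (T : Set I) = Set.range f ∧ IsLowerSet (T : Set I) ∧ T.card = n := by
  have e : ((Finset.univ.map ⟨f, f.injective⟩ : Finset I) : Set I) = Set.range f := by simp
  refine ⟨Finset.univ.map ⟨f, f.injective⟩, e, ?_, by simp⟩
  rw [e]
  rintro a b hba ⟨i, rfl⟩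
  rcases hba.eq_or_lt with rfl | h
  · exact ⟨i, rfl⟩
  · exact f.mem_range_of_rel h

/-- If `ℤ^I` and `ℤ^J` are isomorphic, where `I` has a greatest finite initial segment of size `m`
and `J` has a greatest well-ordered initial segment of type `α`, then `α = m`. -/
theorem eq_natCast_of_zpow_iso {J : Type} [LinearOrder J] {α : Ordinal.{0}} {S : Finset I}
    (hS : IsLowerSet (S : Set I)) (hS' : ∀ i ∉ S, ∃ t ∉ S, t < i)
    (f : InitialSeg ((· < ·) : α.ToType → α.ToType → Prop) ((· < ·) : J → J → Prop))
    (hf : ∀ j ∉ Set.range f, ∃ t ∉ Set.range f, t < j) (e : ZPow I ≃o ZPow J) :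
    α = S.card := by
  rcases lt_trichotomy α S.card with h | h | h
  -- If `α` is a number `a < S.card`, levels `a` and `a + 1` coincide on `ℤ^J`, but a lower set of
  -- `a + 1` indices in `I` separates them on `ℤ^I`.
  · obtain ⟨a, rfl⟩ := Ordinal.lt_omega0.1 (h.trans (Ordinal.natCast_lt_omega0 _))
    rw [Nat.cast_lt] at h
    obtain ⟨g⟩ := Ordinal.type_eq.1 ((Ordinal.type_fin a).trans (Ordinal.type_toType _).symm)
    obtain ⟨T, hT, hTl, hTc⟩ := exists_isLowerSet_of_initialSeg ((g.toInitialSeg).trans f)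
    have hT' : (T : Set J) = Set.range f := by
      rw [hT]
      ext j
      constructor
      · rintro ⟨i, rfl⟩
        exact ⟨g i, rfl⟩
      · rintro ⟨i, rfl⟩
        exact ⟨g.symm i, by simp⟩
    obtain ⟨S₁, hS₁, hc₁⟩ := exists_isLowerSet_card hS (Nat.succ_le_of_lt h)
    obtain ⟨x, y, hxy, hxy'⟩ := exists_finClass_zpow hS₁ hc₁
    rw [← finClass_map_iff e] at hxy hxy'
    rw [← hT'] at hf
    exact absurd (finClass_zpow_stable hTl hTc hf hxy) hxy'
  · exact h
  -- Now the roles are reversed: `J` starts with `S.card + 1` points, while the condensations of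
  -- `ℤ^I` do not grow from level `S.card` to the next.
  · have h1 : ((S.card + 1 : ℕ) : Ordinal) ≤ α := by
      rw [Nat.cast_succ]
      exact Order.succ_le_of_lt h
    rw [← Ordinal.type_fin, ← Ordinal.type_toType α, Ordinal.type_le_iff] at h1
    obtain ⟨g⟩ := h1
    obtain ⟨T, hT, hTl, hTc⟩ := exists_isLowerSet_of_initialSeg (g.trans f)
    obtain ⟨x, y, hxy, hxy'⟩ := exists_finClass_zpow hTl hTc
    rw [← finClass_map_iff e.symm] at hxy hxy'
    exact absurd (finClass_zpow_stable hS rfl hS' hxy) hxy'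

end ZPow

/-! ### Splitting the exponent -/

section Splitting

/-- The greatest index of difference lies in the upper summand `K` unless the two `K`-parts agree,
so the `K`-part is compared first. -/
theorem zpow_sum_iso {I A K : Type*} [LinearOrder I] [LinearOrder A] [LinearOrder K]
    (e : A ⊕ₗ K ≃o I) : Nonempty (ZPow I ≃o ZPow K ×ₗ ZPow A) := by
  let E : (I →₀ ℤ) ≃ (A →₀ ℤ) × (K →₀ ℤ) :=
    (Finsupp.equivCongrLeft (toLex.trans e.toEquiv).symm).trans
      Finsupp.sumFinsuppEquivProdFinsupp
  have hA : ∀ x a, (E x).1 a = x (e (toLex (Sum.inl a))) := fun x a => by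
    simp [E]
  have hK : ∀ x k, (E x).2 k = x (e (toLex (Sum.inr k))) := fun x k => by
    simp [E]
  refine ⟨StrictMono.orderIsoOfSurjective
    (fun x => toLex (toColex (E (ofColex x)).2, toColex (E (ofColex x)).1)) ?_ ?_⟩
  · intro x y hxy
    obtain ⟨i, hi, hlt⟩ := zpow_lt_iff.1 hxy
    obtain ⟨i, rfl⟩ := e.surjective i
    rw [Prod.Lex.toLex_lt_toLex]
    rcases i with a | k
    · right
      constructor
      · refine congrArg toColex (Finsupp.ext fun k => ?_)
        rw [hK, hK]
        exact hi _ (e.strictMono (Sum.Lex.inl_lt_inr _ _))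
      · refine zpow_lt_iff.2 ⟨a, fun b hb => ?_, ?_⟩
        · change (E _).1 b = (E _).1 b
          rw [hA, hA]
          exact hi _ (e.strictMono (Sum.Lex.inl_lt_inl_iff.2 hb))
        · change (E _).1 a < (E _).1 a
          rw [hA, hA]
          exact hlt
    · left
      refine zpow_lt_iff.2 ⟨k, fun b hb => ?_, ?_⟩
      · change (E _).2 b = (E _).2 b
        rw [hK, hK]
        exact hi _ (e.strictMono (Sum.Lex.inr_lt_inr_iff.2 hb))
      · change (E _).2 k < (E _).2 k
        rw [hK, hK]
        exact hlt
  · intro y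
    refine ⟨toColex (E.symm (ofColex (ofLex y).2, ofColex (ofLex y).1)), ?_⟩
    simp

/-- Cantor's theorem. For density, if `x < y` is decided at `i`, adding a unit to `x` at some `t <
i` gives a point in between. -/
theorem zpow_iso_rat (K : Type*) [LinearOrder K] [Countable K] [Nonempty K] [NoMinOrder K] :
    Nonempty (ZPow K ≃o ℚ) := by
  have : Countable (ZPow K) := inferInstanceAs (Countable (K →₀ ℤ))
  have : Nonempty (ZPow K) := ⟨0⟩
  obtain ⟨k⟩ := ‹Nonempty K›
  have hlt : ∀ (x : ZPow K) (t : K) (c : ℤ), 0 < c →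
      x < toColex (ofColex x + Finsupp.single t c) := fun x t c hc =>
    zpow_lt_iff.2 ⟨t, fun j hj => by simp [hj.ne], by simpa using hc⟩
  have : NoMaxOrder (ZPow K) := ⟨fun x => ⟨_, hlt x k 1 one_pos⟩⟩
  have : NoMinOrder (ZPow K) := ⟨fun x => ⟨toColex (ofColex x - Finsupp.single k 1), by
    simpa using hlt (toColex (ofColex x - Finsupp.single k 1)) k 1 one_pos⟩⟩
  have : DenselyOrdered (ZPow K) := ⟨fun x y hxy => by
    obtain ⟨i, hi, hlt'⟩ := zpow_lt_iff.1 hxy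
    obtain ⟨t, ht⟩ := exists_lt i
    refine ⟨_, hlt x t 1 one_pos, zpow_lt_iff.2 ⟨i, fun j hj => ?_, ?_⟩⟩
    · simp [(ht.trans hj).ne, hi j hj]
    · simpa [ht.ne] using hlt'⟩
  exact Order.iso_of_countable_dense _ _

/-- The order `I` is the sum of `S` and its complement, and the power of `ℤ` over the complement is
`ℚ`. This puts the constructed groups in the domain of `OGalpha`. -/
theorem zpow_iso_rat_prod {I : Type} [LinearOrder I] [Countable I] [Nonempty I] {S : Finset I}
    (hS : IsLowerSet (S : Set I)) (hne : ∃ i, i ∉ S) (hS' : ∀ i ∉ S, ∃ t ∉ S, t < i) :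
    Nonempty (ZPow I ≃o ℚ ×ₗ ZPow (S.card : Ordinal.{0}).ToType) := by
  let K := {i // i ∉ S}
  obtain ⟨g⟩ := Ordinal.type_eq.1
    ((Ordinal.type_toType (S.card : Ordinal.{0})).trans (Ordinal.type_fin S.card).symm)
  let a (x : (S.card : Ordinal.{0}).ToType) : I := S.orderIsoOfFin rfl (g x)
  have haS : ∀ x, a x ∈ S := fun x => (S.orderIsoOfFin rfl (g x)).2
  have ha : StrictMono a := fun x y hxy =>
    (S.orderIsoOfFin rfl).strictMono (g.map_rel_iff.2 hxy)
  have hmono : StrictMono fun x : (S.card : Ordinal.{0}).ToType ⊕ₗ K =>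
      Sum.elim a Subtype.val (ofLex x) := by
    intro x y hxy
    rcases x with x | x <;> rcases y with y | y
    · exact ha (Sum.Lex.inl_lt_inl_iff.1 hxy)
    · change a x < y
      by_contra hlt
      exact y.2 (hS (not_lt.1 hlt) (haS x))
    · exact absurd hxy Sum.Lex.not_inr_lt_inl
    · have h : x < y := Sum.Lex.inr_lt_inr_iff.1 hxy
      exact h
  have hsurj : Function.Surjective fun x : (S.card : Ordinal.{0}).ToType ⊕ₗ K =>
      Sum.elim a Subtype.val (ofLex x) := by
    intro i
    by_cases hi : i ∈ S
    · refine ⟨toLex (Sum.inl (g.symm ((S.orderIsoOfFin rfl).symm ⟨i, hi⟩))), ?_⟩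
      change ((S.orderIsoOfFin rfl (g (g.symm ((S.orderIsoOfFin rfl).symm ⟨i, hi⟩))) : S) : I) = i
      rw [g.apply_symm_apply, OrderIso.apply_symm_apply]
    · exact ⟨toLex (Sum.inr ⟨i, hi⟩), rfl⟩
  have : Nonempty K := hne.elim fun i hi => ⟨⟨i, hi⟩⟩
  have : NoMinOrder K := ⟨fun ⟨i, hi⟩ => by
    obtain ⟨t, ht, hti⟩ := hS' i hi
    exact ⟨⟨t, ht⟩, hti⟩⟩
  obtain ⟨e₁⟩ := zpow_sum_iso (hmono.orderIsoOfSurjective _ hsurj)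
  obtain ⟨e₂⟩ := zpow_iso_rat K
  exact ⟨e₁.trans (Prod.Lex.prodLexCongr e₂ (OrderIso.refl _))⟩

end Splitting

/-! ### Uniqueness of the exponent -/

section OrderType

theorem HasOrderType.eq_natCast {G : NatOrderedGroup} {α : Ordinal.{0}} (hG : HasOrderType G α)
    {I : Type*} [LinearOrder I] {S : Finset I} (hS : IsLowerSet (S : Set I))
    (hS' : ∀ i ∉ S, ∃ t ∉ S, t < i) (e : G.Elem ≃o ZPow I) : α = S.card := by
  rcases hG with ⟨⟨e'⟩⟩ | ⟨⟨e'⟩⟩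
  · exact eq_natCast_of_zpow_iso hS hS' (InitialSeg.refl _) (fun j hj => absurd ⟨j, rfl⟩ hj)
      (e.symm.trans e')
  -- Writing `ℚ` as `ℤ^(ℕᵒᵈ)` turns `ℤ^α ℚ` into a pure power with exponent `α ⊕ₗ ℕᵒᵈ`. Above `α`
  -- this exponent has no least element, so both shapes fall under `eq_natCast_of_zpow_iso`.
  · obtain ⟨e₁⟩ := zpow_sum_iso (OrderIso.refl (α.ToType ⊕ₗ ℕᵒᵈ))
    obtain ⟨e₂⟩ := zpow_iso_rat ℕᵒᵈ
    refine eq_natCast_of_zpow_iso hS hS'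
      (J := α.ToType ⊕ₗ ℕᵒᵈ) (InitialSeg.leAdd _ _) ?_ (e.symm.trans (e'.trans
        ((Prod.Lex.prodLexCongr e₂.symm (OrderIso.refl _)).trans e₁.symm)))
    rintro (j | j) hj
    · exact absurd ⟨j, rfl⟩ hj
    · refine ⟨toLex (Sum.inr (OrderDual.toDual (OrderDual.ofDual j + 1))), ?_, ?_⟩
      · rintro ⟨i, hi⟩
        cases hi
      · exact Sum.Lex.inr_lt_inr_iff.2 (Nat.lt_succ_self (OrderDual.ofDual j))

end OrderType

/-! ### Copies of ordinals and their finite pieces -/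

section Copies

variable {X Y : Type*} [LinearOrder X] [LinearOrder Y]

open Classical in
/-- The copy of a linear order on the set of natural numbers that is the range of `f`. -/
noncomputable def copyName (f : X → ℕ) : Baire := fun n =>
  if n % 2 = 0 then (if n / 2 ∈ Set.range f then 1 else 0)
  else if ∃ x y : X, x < y ∧ n / 2 = Nat.pair (f x) (f y) then 1 else 0

theorem mem_copySet_copyName {f : X → ℕ} {n : ℕ} : n ∈ copySet (copyName f) ↔ n ∈ Set.range f := by
  simp [copySet, copyName]

theorem copyName_odd_eq_one_iff {f : X → ℕ} {a b : ℕ} :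
    copyName f (2 * Nat.pair a b + 1) = 1 ↔ ∃ x y : X, x < y ∧ f x = a ∧ f y = b := by
  have e1 : (2 * Nat.pair a b + 1) % 2 = 1 := by omega
  have e2 : (2 * Nat.pair a b + 1) / 2 = Nat.pair a b := by omega
  simp [copyName, e1, e2, Nat.pair_eq_pair, eq_comm]

/-- An entry at a position below `M` concerns only labels below `M`, since `Nat.pair` bounds both of
its arguments. Points with larger labels are therefore invisible there. -/
theorem copyName_comp {f : X → ℕ} {g : Y → X} (hg : StrictMono g) {M : ℕ}
    (h : ∀ x, f x < M → x ∈ Set.range g) {n : ℕ} (hn : n < M) :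
    copyName (f ∘ g) n = copyName f n := by
  unfold copyName
  congr 1
  · congr 1
    rw [eq_iff_iff]
    constructor
    · rintro ⟨y, hy⟩
      exact ⟨g y, hy⟩
    · rintro ⟨x, hx⟩
      obtain ⟨y, rfl⟩ := h x (by omega)
      exact ⟨y, hx⟩
  · congr 1
    rw [eq_iff_iff]
    constructor
    · rintro ⟨x, y, hxy, e⟩
      exact ⟨g x, g y, hg hxy, e⟩
    · rintro ⟨x, y, hxy, e⟩
      have h1 := Nat.left_le_pair (f x) (f y)
      have h2 := Nat.right_le_pair (f x) (f y)
      obtain ⟨x, rfl⟩ := h x (by omega)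
      obtain ⟨y, rfl⟩ := h y (by omega)
      exact ⟨x, y, hg.lt_iff_lt.1 hxy, e⟩

theorem isCopy_copyName {o : Ordinal.{0}} {f : o.ToType → ℕ} (hf : Function.Injective f) :
    IsCopy (copyName f) o := by
  let e : o.ToType ≃ copySet (copyName f) :=
    Equiv.ofBijective (fun x => ⟨f x, mem_copySet_copyName.2 ⟨x, rfl⟩⟩)
      ⟨fun x y h => hf (congrArg Subtype.val h), fun ⟨n, hn⟩ => by
        obtain ⟨x, hx⟩ := mem_copySet_copyName.1 hn
        exact ⟨x, Subtype.ext hx⟩⟩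
  have he : ∀ x y, copyRel (copyName f) (e x) (e y) ↔ x < y := by
    intro x y
    refine copyName_odd_eq_one_iff.trans ⟨?_, fun h => ⟨x, y, h, rfl, rfl⟩⟩
    rintro ⟨x', y', h, hx, hy⟩
    rw [← hf hx, ← hf hy]
    exact h
  let E : ((· < ·) : o.ToType → o.ToType → Prop) ≃r copyRel (copyName f) :=
    ⟨e, fun {a b} => he a b⟩
  have hw : IsWellOrder (copySet (copyName f)) (copyRel (copyName f)) :=
    E.symm.toRelEmbedding.isWellOrder
  refine ⟨fun n => ?_, fun a b h => ?_, hw, ?_⟩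
  · unfold copyName
    split_ifs <;> simp
  · obtain ⟨x, y, -, hx, hy⟩ := copyName_odd_eq_one_iff.1 h
    exact ⟨mem_copySet_copyName.2 ⟨x, hx⟩, mem_copySet_copyName.2 ⟨y, hy⟩⟩
  · exact (Ordinal.type_eq.2 ⟨E⟩).symm.trans (Ordinal.type_toType o)

theorem IsCopy.exists_eq_copyName {p : Baire} {o : Ordinal.{0}} (h : IsCopy p o) :
    ∃ f : o.ToType → ℕ, Function.Injective f ∧ p = copyName f := by
  obtain ⟨h01, hmem, hw, ho⟩ := h
  obtain ⟨e⟩ := Ordinal.type_eq.1 (ho.trans (Ordinal.type_toType o).symm)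
  refine ⟨fun x => (e.symm x : ℕ), fun x y hxy => e.symm.injective (Subtype.ext hxy), ?_⟩
  have key : ∀ n (q : Baire), (∀ n, q n = 0 ∨ q n = 1) → (p n = 1 ↔ q n = 1) → p n = q n := by
    intro n q hq hpq
    rcases h01 n with h | h <;> rcases hq n with h' | h' <;> simp_all
  funext n
  refine key n _ (fun n => by unfold copyName; split_ifs <;> simp) ?_
  rcases Nat.even_or_odd' n with ⟨c, rfl | rfl⟩
  · change c ∈ copySet p ↔ c ∈ copySet _
    rw [mem_copySet_copyName]
    constructor
    · intro hc
      exact ⟨e ⟨c, hc⟩, by simp⟩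
    · rintro ⟨x, rfl⟩
      exact (e.symm x).2
  · obtain ⟨a, b, rfl⟩ : ∃ a b, c = Nat.pair a b := ⟨_, _, (Nat.pair_unpair c).symm⟩
    rw [copyName_odd_eq_one_iff]
    constructor
    · intro hab
      obtain ⟨ha, hb⟩ := hmem a b hab
      refine ⟨e ⟨a, ha⟩, e ⟨b, hb⟩, ?_, by simp, by simp⟩
      rw [e.map_rel_iff]
      exact hab
    · rintro ⟨x, y, hxy, rfl, rfl⟩
      have : copyRel p (e.symm x) (e.symm y) := e.symm.map_rel_iff.2 hxy
      exact this

/-- The name of the finite linear order on the entries of the list `L` in which they are listed. -/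
def listName (L : List ℕ) : Baire := fun n =>
  if n % 2 = 0 then (if L.idxOf (n / 2) < L.length then 1 else 0)
  else if L.idxOf (n / 2).unpair.1 < L.idxOf (n / 2).unpair.2 ∧
    L.idxOf (n / 2).unpair.2 < L.length then 1 else 0

theorem listName_eq_copyName {L : List ℕ} (hL : L.Nodup) : listName L = copyName L.get := by
  funext n
  unfold listName copyName
  congr 1
  · congr 1
    rw [eq_iff_iff, List.idxOf_lt_length_iff, List.mem_iff_get]
    rfl
  · congr 1
    rw [eq_iff_iff]
    constructor
    · rintro ⟨h1, h2⟩
      refine ⟨⟨_, h1.trans h2⟩, ⟨_, h2⟩, h1, ?_⟩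
      simp
    · rintro ⟨x, y, hxy, e⟩
      rw [e, Nat.unpair_pair]
      simpa [hL.idxOf_getElem] using hxy

/-- The first `L.length` points of `o` take their labels from `L` in order, and the others take
labels too large to be seen below `M`. -/
theorem exists_isCopy_of_length_le {L : List ℕ} (hL : L.Nodup) {o : Ordinal.{0}}
    (ho : o.card ≤ Cardinal.aleph0) (hLo : (L.length : Ordinal.{0}) ≤ o) (M : ℕ) :
    ∃ r, IsCopy r o ∧ ∀ i < M, r i = listName L i := by
  classical
  have hc : Countable o.ToType := by
    rw [← Cardinal.mk_le_aleph0_iff, Cardinal.mk_toType]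
    exact ho
  obtain ⟨f₀, hf₀⟩ := exists_injective_nat o.ToType
  rw [← Ordinal.type_fin, ← Ordinal.type_toType o, Ordinal.type_le_iff] at hLo
  obtain ⟨g⟩ := hLo
  have hg : StrictMono g := fun i j hij => g.map_rel_iff.2 hij
  -- Larger than every entry of `L`, for injectivity, and than `M`, for invisibility.
  let B := M + L.sum + 1
  have hB : ∀ i, L.get i < B := fun i => by
    have := List.single_le_sum (l := L) (fun _ _ => Nat.zero_le _) _ (L.get_mem i)
    omega
  let f (x : o.ToType) : ℕ := if h : ∃ i, g i = x then L.get h.choose else B + f₀ x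
  have hfg : ∀ i, f (g i) = L.get i := by
    intro i
    have h : ∃ j, g j = g i := ⟨i, rfl⟩
    simp only [f, dif_pos h]
    rw [g.injective h.choose_spec]
  have hf' : ∀ x, (¬ ∃ i, g i = x) → f x = B + f₀ x := fun x hx => dif_neg hx
  have hf : Function.Injective f := by
    intro x y hxy
    by_cases hx : ∃ i, g i = x <;> by_cases hy : ∃ i, g i = y
    · obtain ⟨i, rfl⟩ := hx
      obtain ⟨j, rfl⟩ := hy
      rw [hfg, hfg] at hxy
      rw [List.nodup_iff_injective_get.1 hL hxy]
    · obtain ⟨i, rfl⟩ := hx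
      rw [hfg, hf' y hy] at hxy
      have := hB i
      omega
    · obtain ⟨i, rfl⟩ := hy
      rw [hfg, hf' x hx] at hxy
      have := hB i
      omega
    · rw [hf' x hx, hf' y hy] at hxy
      exact hf₀ (by omega)
  refine ⟨copyName f, isCopy_copyName hf, fun i hi => ?_⟩
  rw [listName_eq_copyName hL, ← copyName_comp hg (M := M) (fun x hx => ?_) hi]
  · congr 1
    funext i
    exact hfg i
  · by_contra hx'
    rw [hf' x hx'] at hx
    omega

/-- Only finitely many points have a label below `M`; `L` lists their labels in the order of `o`. -/
theorem IsCopy.exists_list {r : Baire} {o : Ordinal.{0}} (h : IsCopy r o) (M : ℕ) :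
    ∃ L : List ℕ, L.Nodup ∧ (L.length : Ordinal.{0}) ≤ o ∧ ∀ i < M, r i = listName L i := by
  obtain ⟨f, hf, rfl⟩ := h.exists_eq_copyName
  have hfin : {x | f x < M}.Finite := (Set.finite_lt_nat M).preimage hf.injOn
  let T := hfin.toFinset
  let L := List.ofFn (fun i => f (T.orderEmbOfFin rfl i))
  have hl : L.length = T.card := by simp [L]
  have hL : L.Nodup := List.nodup_ofFn.2 (hf.comp (T.orderEmbOfFin rfl).injective)
  refine ⟨L, hL, ?_, fun i hi => ?_⟩
  · rw [hl, ← Ordinal.nat_le_card]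
    have := Cardinal.mk_set_le (T : Set o.ToType)
    rw [Cardinal.mk_toType] at this
    exact (Cardinal.mk_coe_finset (s := T)).symm.trans_le this
  · let g (i : Fin L.length) : o.ToType := T.orderEmbOfFin rfl (Fin.cast hl i)
    have hg : StrictMono g := fun i j hij => (T.orderEmbOfFin rfl).strictMono hij
    rw [listName_eq_copyName hL, ← copyName_comp hg (M := M) (fun x hx => ?_) hi]
    · congr 1
      funext i
      simp [L, g, Fin.cast]
    · have hxT : x ∈ Set.range (T.orderEmbOfFin rfl) := by
        rw [Finset.range_orderEmbOfFin]
        exact (hfin.mem_toFinset).2 hx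
      obtain ⟨j, hj⟩ := hxT
      exact ⟨Fin.cast hl.symm j, hj⟩

end Copies

/-! ### The upper bound -/

section UpperBound

theorem primrec_listName : Primrec₂ listName := by
  have hL : Primrec fun x : List ℕ × ℕ => x.1 := Primrec.fst
  have hlen : Primrec fun x : List ℕ × ℕ => x.1.length := Primrec.list_length.comp hL
  have hn : Primrec fun x : List ℕ × ℕ => x.2 / 2 :=
    Primrec.nat_div.comp Primrec.snd (Primrec.const 2)
  have hu : Primrec fun x : List ℕ × ℕ => (x.2 / 2).unpair := Primrec.unpair.comp hn
  have h1 : Primrec fun x : List ℕ × ℕ => x.1.idxOf (x.2 / 2).unpair.1 :=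
    Primrec.list_idxOf.comp (Primrec.fst.comp hu) hL
  have h2 : Primrec fun x : List ℕ × ℕ => x.1.idxOf (x.2 / 2).unpair.2 :=
    Primrec.list_idxOf.comp (Primrec.snd.comp hu) hL
  exact Primrec.ite (Primrec.eq.comp (Primrec.nat_mod.comp Primrec.snd (Primrec.const 2))
    (Primrec.const 0))
    (Primrec.ite (Primrec.nat_lt.comp (Primrec.list_idxOf.comp hn hL) hlen) (Primrec.const 1)
      (Primrec.const 0))
    (Primrec.ite ((Primrec.nat_lt.comp h1 h2).and (Primrec.nat_lt.comp h2 hlen)) (Primrec.const 1)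
      (Primrec.const 0))

theorem primrec_nodup : PrimrecPred fun L : List ℕ => L.Nodup := by
  refine (primrecPred_forall_lt (R := fun (L : List ℕ) i => L.idxOf (L.getD i 0) = i)
    (Primrec.eq.comp (Primrec.list_idxOf.comp ((Primrec.list_getD 0).comp Primrec.fst Primrec.snd)
      Primrec.fst) Primrec.snd) Primrec.list_length).of_eq fun L => ?_
  constructor
  · intro h
    refine List.nodup_iff_injective_get.2 fun i j hij => Fin.ext ?_
    rw [← h i i.2, ← h j j.2, List.getD_eq_getElem _ _ i.2, List.getD_eq_getElem _ _ j.2]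
    exact congrArg L.idxOf hij
  · intro h i hi
    rw [List.getD_eq_getElem _ _ hi, h.idxOf_getElem]

/-- The first `M` entries of the join of `σ` and the name of the order listed in `L`. -/
def joinListName (σ L : List ℕ) (M : ℕ) : List ℕ :=
  (List.range M).map fun n => if n % 2 = 0 then σ.getD (n / 2) 0 else listName L (n / 2)

theorem primrec_joinListName :
    Primrec fun x : List ℕ × List ℕ × ℕ => joinListName x.1 x.2.1 x.2.2 := by
  have hn : Primrec fun x : (List ℕ × List ℕ × ℕ) × ℕ => x.2 / 2 :=
    Primrec.nat_div.comp Primrec.snd (Primrec.const 2)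
  exact Primrec.list_map (Primrec.list_range.comp (Primrec.snd.comp Primrec.snd))
    (Primrec.ite (Primrec.eq.comp (Primrec.nat_mod.comp Primrec.snd (Primrec.const 2))
      (Primrec.const 0)) ((Primrec.list_getD 0).comp (Primrec.fst.comp Primrec.fst) hn)
      (primrec_listName.comp (Primrec.fst.comp (Primrec.snd.comp Primrec.fst)) hn)).to₂

theorem joinListName_initSeg {p : Baire} {a M : ℕ} (L : List ℕ) (h : M ≤ a) :
    joinListName (initSeg p a) L M = initSeg (join p (listName L)) M := by
  refine List.map_congr_left fun n hn => ?_
  have := List.mem_range.1 hn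
  rw [getD_initSeg (by omega)]
  rfl

/-- The pair of a list and a bound that is coded by a natural number. -/
def fragment (e : ℕ) : List ℕ × ℕ := Denumerable.ofNat (List ℕ × ℕ) e

theorem primrec_fragment : Primrec fragment := Primrec.ofNat _

theorem fragment_surjective (x : List ℕ × ℕ) : ∃ e, fragment e = x :=
  ⟨Encodable.encode x, Denumerable.ofNat_encode x⟩

/-- The first value that the procedure `g` computes from `σ` and the `e`-th finite fragment of a
copy of an ordinal. -/
def fragmentValue (g : List ℕ → List ℕ) (σ : List ℕ) (e : ℕ) : Option ℕ :=
  bif decide ((fragment e).2 ≤ σ.length ∧ (fragment e).1.Nodup) then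
    (g (joinListName σ (fragment e).1 (fragment e).2))[0]?
  else none

theorem computable_fragmentValue {g : List ℕ → List ℕ} (hg : Computable g) :
    Computable₂ (fragmentValue g) := by
  have he : Primrec fun x : List ℕ × ℕ => fragment x.2 := primrec_fragment.comp Primrec.snd
  have hc : PrimrecPred fun x : List ℕ × ℕ =>
      (fragment x.2).2 ≤ x.1.length ∧ (fragment x.2).1.Nodup :=
    (Primrec.nat_le.comp (Primrec.snd.comp he) (Primrec.list_length.comp Primrec.fst)).and
      (primrec_nodup.comp (Primrec.fst.comp he))
  exact Computable.cond hc.decide.to_comp (Computable.list_getElem?.comp (hg.comp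
    (primrec_joinListName.comp (Primrec.fst.pair he)).to_comp) (Computable.const 0))
    (Computable.const none)

/-- The length `a` enters only through a lower bound, so a value found at one stage persists at all
later ones. -/
theorem fragmentValue_initSeg_eq_some_iff {g : List ℕ → List ℕ} {p : Baire} {a e v : ℕ} :
    fragmentValue g (initSeg p a) e = some v ↔ (fragment e).2 ≤ a ∧ (fragment e).1.Nodup ∧
      (g (initSeg (join p (listName (fragment e).1)) (fragment e).2))[0]? = some v := by
  unfold fragmentValue
  rw [length_initSeg]
  by_cases h : (fragment e).2 ≤ a ∧ (fragment e).1.Nodup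
  · rw [decide_eq_true h, cond_true, joinListName_initSeg _ h.1]
    exact ⟨fun h' => ⟨h.1, h.2, h'⟩, fun h' => h'.2.2⟩
  · rw [decide_eq_false h, cond_false]
    exact ⟨fun h' => by simp at h', fun h' => absurd ⟨h'.1, h'.2.1⟩ h⟩

/-- The instance of `Min` lists sizes of fragments on which the backward functional gives a value.
Its minimum is at most the size of every correct ordinal `α`, so a value on a fragment of minimal
size is the value on some genuine copy of `α`. -/
theorem wle_min_of_wle_ordRep {X : RepSpace.{u}} {Z : RepSpace.{v}} {P : Problem X ordRep}
    {Q : Problem Z natRep} (hQP : WLE Q P) : WLE Q Min := by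
  obtain ⟨Φ, Ψ, -, cΨ, H⟩ := hQP
  obtain ⟨g, cg, -, Hg⟩ := cΨ.exists_approx
  let size (e : ℕ) : ℕ := (fragment e).1.length
  have csize : Computable size :=
    (Primrec.list_length.comp (Primrec.fst.comp primrec_fragment)).to_comp
  have cval := computable_fragmentValue cg
  -- The `n`-th term tries fragment `n` first and then the fragments `0, 1, …`: it is total as soon
  -- as one fragment has a value, and no fragment with a value is missed.
  let shift (n i : ℕ) : ℕ := i.casesOn n id
  have cshift : Computable₂ shift :=
    (Primrec.nat_casesOn Primrec.snd Primrec.fst Primrec.snd.to₂).to_comp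
  let f (σ : List ℕ) (n i : ℕ) : Option ℕ :=
    (fragmentValue g σ (shift n i)).map fun _ => size (shift n i)
  obtain ⟨Φ', cΦ', HΦ'⟩ := exists_functional
    -- Waiting for this length settles whether fragment `n` has a value before others are tried in
    -- its place.
    (h := fun σ n => bif decide ((fragment n).2 ≤ σ.length) then
      firstSome (f σ n) (σ.length + 1) else none) (by
    have hs : Computable fun x : (List ℕ × ℕ) × ℕ => shift x.1.2 x.2 :=
      cshift.comp (Computable.snd.comp Computable.fst) Computable.snd
    refine Computable.cond ((Primrec.nat_le.comp (Primrec.snd.comp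
      (primrec_fragment.comp Primrec.snd)) (Primrec.list_length.comp Primrec.fst)).decide.to_comp)
      (computable_firstSome (f := fun (x : List ℕ × ℕ) i => f x.1 x.2 i) ?_
        (Computable.succ.comp (Computable.list_length.comp Computable.fst))) (Computable.const none)
    exact Computable.option_map (cval.comp (Computable.fst.comp Computable.fst) hs)
      (csize.comp (hs.comp Computable.fst)).to₂)
  obtain ⟨Ψ', cΨ', HΨ'⟩ := exists_functional_join_nat
    (h := fun σ τ => firstSome (fun e => bif decide (τ[0]? = some (size e)) then
      fragmentValue g σ e else none) σ.length) (by
    refine computable_firstSome (Computable.cond ?_ (cval.comp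
      (Computable.fst.comp Computable.fst) Computable.snd) (Computable.const none))
      (Computable.list_length.comp Computable.fst)
    exact (Primrec.eq.comp (Primrec.list_getElem?.comp (Primrec.snd.comp Primrec.fst)
      (Primrec.const 0)) (Primrec.option_some.comp (Primrec.list_length.comp (Primrec.fst.comp
        (primrec_fragment.comp Primrec.snd))))).decide.to_comp)
  refine ⟨Φ', Ψ', cΦ', cΨ', fun p x hp hx => ?_⟩
  obtain ⟨q₀, -, z, -, ⟨⟨α, hα⟩, hαz⟩, K⟩ := H p x hp hx
  -- every copy of `α` has a fragment on which `Ψ` is defined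
  have hexists : ∃ e v, (∀ a ≥ (fragment e).2, fragmentValue g (initSeg p a) e = some v) ∧
      (size e : Ordinal.{0}) ≤ α := by
    obtain ⟨r, hr⟩ := IsCopy.surjective α hα
    obtain ⟨s, hs, -⟩ := K r ⟨α, hα⟩ hr hαz
    obtain ⟨hs1, hs2⟩ := Hg _ _ hs
    obtain ⟨M, hM⟩ := hs2 1
    obtain ⟨L, hL, hLα, hrL⟩ := hr.exists_list M
    obtain ⟨e, he⟩ := fragment_surjective (L, M)
    refine ⟨e, s 0, fun a ha => fragmentValue_initSeg_eq_some_iff.2 ⟨ha, ?_, ?_⟩, ?_⟩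
    · rwa [he]
    · rw [he]
      dsimp only
      rw [initSeg_congr (q := join p r) fun i hi => ?_, hs1 M, getElem?_initSeg,
        if_pos (by have := hM M le_rfl; omega)]
      simp only [join]
      split_ifs
      · rfl
      · exact (hrL _ (by omega)).symm
    · simpa only [size, he] using hLα
  -- and the values on the fragments of size at most `α` are correct
  have hcorrect : ∀ a e (v : natRep), fragmentValue g (initSeg p a) e = some v →
      (size e : Ordinal.{0}) ≤ α → v ∈ Q x := by
    intro a e v hv hle
    obtain ⟨-, hL, hv⟩ := fragmentValue_initSeg_eq_some_iff.1 hv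
    obtain ⟨r, hr, hrL⟩ := exists_isCopy_of_length_le hL hα hle (fragment e).2
    obtain ⟨s, hs, y, hy, hyx⟩ := K r ⟨α, hα⟩ hr hαz
    obtain ⟨hs1, -⟩ := Hg _ _ hs
    rw [initSeg_congr (q := join p r) fun i hi => ?_, hs1, getElem?_initSeg] at hv
    · split_ifs at hv
      obtain rfl : s 0 = v := Option.some.inj hv
      obtain ⟨rfl, -⟩ := hy
      exact hyx
    · simp only [join]
      split_ifs
      · rfl
      · exact (hrL _ (by omega)).symm
  obtain ⟨e₀, v₀, he₀, hle₀⟩ := hexists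
  obtain ⟨q, hq, hqn⟩ := HΦ' p fun n => by
    let a := max (fragment n).2 (max (fragment e₀).2 (e₀ + 1))
    have h1 : (fragment n).2 ≤ a := le_max_left _ _
    have h2 : (fragment e₀).2 ≤ a := (le_max_left _ _).trans (le_max_right _ _)
    have h3 : e₀ + 1 ≤ a := (le_max_right _ _).trans (le_max_right _ _)
    refine ⟨a, ?_⟩
    simp only [length_initSeg, h1, decide_true, cond_true]
    refine firstSome_isSome (i := e₀ + 1) (v := size e₀) (by omega) ?_
    simp only [f, shift, id, he₀ a h2, Option.map_some]
  have hq₁ : ∀ n, ∃ e a v, fragmentValue g (initSeg p a) e = some v ∧ q n = size e := by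
    intro n
    obtain ⟨a, ha⟩ := hqn n
    by_cases h1 : (fragment n).2 ≤ (initSeg p a).length
    · simp only [h1, decide_true, cond_true] at ha
      obtain ⟨i, -, hi⟩ := exists_of_firstSome ha
      obtain ⟨v, hv, hvq⟩ := Option.map_eq_some_iff.1 hi
      exact ⟨_, a, v, hv, hvq.symm⟩
    · simp only [h1, decide_false, cond_false, reduceCtorEq] at ha
  have hq₂ : q e₀ = size e₀ := by
    obtain ⟨a, ha⟩ := hqn e₀
    by_cases h1 : (fragment e₀).2 ≤ (initSeg p a).length
    · simp only [h1, decide_true, cond_true] at ha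
      have h2 : firstSome (f (initSeg p a) e₀) 1 = some (size e₀) := by
        rw [length_initSeg] at h1
        simp [firstSome, f, shift, he₀ a h1]
      rw [firstSome_mono h2 (by omega)] at ha
      exact (Option.some.inj ha).symm
    · simp only [h1, decide_false, cond_false, reduceCtorEq] at ha
  refine ⟨q, hq, q, rfl, ?_, ?_⟩
  · obtain ⟨v, hv, hv'⟩ := WellFounded.has_min (wellFounded_lt (α := ℕ)) (Set.range q)
      ⟨_, 0, rfl⟩
    exact ⟨v, hv, fun w hw => not_lt.1 (hv' w hw)⟩
  · intro r (m : ℕ)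
    rintro ⟨hr : r 0 = m, -⟩ ⟨⟨n, hn⟩, hmin⟩
    -- The minimum is bounded by the size of the fragment `e₀` of an actual copy of `α`.
    have hmα : (m : Ordinal.{0}) ≤ α := by
      refine le_trans ?_ hle₀
      rw [Nat.cast_le, ← hq₂]
      exact hmin ⟨_, rfl⟩
    obtain ⟨e, a, v, hev, hqe⟩ := hq₁ n
    obtain ⟨s, hs, a', b, w, hw, hsw⟩ := HΨ' p r ⟨max (fragment e).2 (e + 1), by
      have h1 : (fragment e).2 ≤ max (fragment e).2 (e + 1) := le_max_left _ _
      have h2 : e + 1 ≤ max (fragment e).2 (e + 1) := le_max_right _ _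
      refine firstSome_isSome (i := e) (v := v) (by rw [length_initSeg]; omega) ?_
      have h3 : (initSeg r (max (fragment e).2 (e + 1)))[0]? = some (size e) := by
        rw [getElem?_initSeg, if_pos (by omega), hr, ← hn, hqe]
      simp only [h3, decide_true, cond_true]
      obtain ⟨-, hev⟩ := fragmentValue_initSeg_eq_some_iff.1 hev
      exact fragmentValue_initSeg_eq_some_iff.2 ⟨h1, hev⟩⟩
    refine ⟨s, hs, w, hsw, ?_⟩
    obtain ⟨e', -, he'⟩ := exists_of_firstSome hw
    by_cases h1 : (initSeg r b)[0]? = some (size e')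
    · simp only [h1, decide_true, cond_true] at he'
      refine hcorrect _ _ _ he' ?_
      rw [getElem?_initSeg] at h1
      split_ifs at h1
      rw [← Option.some.inj h1, hr]
      exact hmα
    · simp [h1] at he'

end UpperBound

/-! ### The order of indices computed from a sequence -/

section IndexOrder

/-- The least of `i` and `p 0, …, p i`. -/
def level (p : Baire) (i : ℕ) : ℕ := (initSeg p (i + 1)).foldr min i

theorem le_foldr_min_iff {l : List ℕ} {v d : ℕ} : v ≤ l.foldr min d ↔ v ≤ d ∧ ∀ x ∈ l, v ≤ x := by
  induction l with
  | nil => simp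
  | cons a l ih =>
    rw [List.foldr_cons, le_min_iff, ih]
    simp only [List.mem_cons, forall_eq_or_imp]
    tauto

theorem le_level_iff {p : Baire} {i v : ℕ} : v ≤ level p i ↔ v ≤ i ∧ ∀ j ≤ i, v ≤ p j := by
  rw [level, le_foldr_min_iff]
  simp [initSeg]

/-- The natural numbers, ordered by their levels, and in reverse within each level. -/
def Idx (_ : Baire) : Type := ℕ

/-- The position of an index in the order. -/
def Idx.key {p : Baire} (i : Idx p) : ℕ ×ₗ ℕᵒᵈ := toLex (level p i, OrderDual.toDual i)

noncomputable instance (p : Baire) : LinearOrder (Idx p) :=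
  LinearOrder.lift' Idx.key fun i j h => by
    have h' := congrArg (fun x : ℕ ×ₗ ℕᵒᵈ => (ofLex x).2) h
    exact h'

theorem Idx.lt_iff {p : Baire} {i j : ℕ} : (show Idx p from i) < (show Idx p from j) ↔
    level p i < level p j ∨ level p i = level p j ∧ j < i :=
  Prod.Lex.toLex_lt_toLex

instance (p : Baire) : Countable (Idx p) := inferInstanceAs (Countable ℕ)

instance (p : Baire) : Nonempty (Idx p) := inferInstanceAs (Nonempty ℕ)

/-- The first `m` indices. -/
def Idx.initial (p : Baire) (m : ℕ) : Finset (Idx p) := Finset.range m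

theorem Idx.mem_initial {p : Baire} {m i : ℕ} : (show Idx p from i) ∈ Idx.initial p m ↔ i < m :=
  Finset.mem_range

theorem Idx.card_initial (p : Baire) (m : ℕ) : (Idx.initial p m).card = m := Finset.card_range m

variable {p : Baire} {m : ℕ}

/-- Indices below `m` have level below `m`, whereas the others have level at least `m`. -/
theorem Idx.isLowerSet_initial (hm : IsLeast (Set.range p) m) :
    IsLowerSet (Idx.initial p m : Set (Idx p)) := by
  have hp : ∀ j, m ≤ p j := fun j => hm.2 ⟨j, rfl⟩
  intro (i : ℕ) (j : ℕ) hji hi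
  have hi : i < m := Idx.mem_initial.1 hi
  refine Idx.mem_initial.2 ?_
  by_contra hj
  have h1 : m ≤ level p j := le_level_iff.2 ⟨not_lt.1 hj, fun k _ => hp k⟩
  have h2 : level p i ≤ i := (le_level_iff.1 le_rfl).1
  exact hji.not_gt (Idx.lt_iff.2 (Or.inl (by omega)))

/-- An index `t` beyond both `i` and a position of the minimum has level at most `m`, hence at most
that of `i`; ties are ordered in reverse. -/
theorem Idx.exists_lt_of_notMem_initial (hm : IsLeast (Set.range p) m) :
    ∀ i ∉ Idx.initial p m, ∃ t ∉ Idx.initial p m, t < i := by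
  obtain ⟨⟨n, hn⟩, hm⟩ := hm
  have hp : ∀ j, m ≤ p j := fun j => hm ⟨j, rfl⟩
  intro (i : ℕ) hi
  have hi : ¬ i < m := fun h => hi (Idx.mem_initial.2 h)
  let t : ℕ := max n i + 1
  have ht : n < t ∧ i < t := ⟨by omega, by omega⟩
  refine ⟨t, fun h => ?_, Idx.lt_iff.2 ?_⟩
  · have := Idx.mem_initial.1 h
    omega
  · have h1 : m ≤ level p i := le_level_iff.2 ⟨not_lt.1 hi, fun k _ => hp k⟩
    have h2 : level p t ≤ p n := (le_level_iff.1 le_rfl).2 n ht.1.le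
    rcases (h2.trans (hn.trans_le h1)).lt_or_eq with h | h
    · exact Or.inl h
    · exact Or.inr ⟨h, ht.2⟩

end IndexOrder

/-! ### Codes for the elements of `ℤ^I` -/

section Codes

/-- The list of pairs coded by a natural number. -/
def pairList (n : ℕ) : List (ℕ × ℕ) := Denumerable.ofNat (List (ℕ × ℕ)) n

/-- The positive part of the `i`-th coefficient of the element coded by `n`. -/
def posCoeff (n i : ℕ) : ℕ := ((pairList n).getD i (0, 0)).1

/-- The negative part of the `i`-th coefficient of the element coded by `n`. -/
def negCoeff (n i : ℕ) : ℕ := ((pairList n).getD i (0, 0)).2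

/-- A bound for the support of the element coded by `n`. -/
def codeLength (n : ℕ) : ℕ := (pairList n).length

theorem coeff_eq_zero {n i : ℕ} (h : codeLength n ≤ i) : posCoeff n i = 0 ∧ negCoeff n i = 0 := by
  unfold posCoeff negCoeff
  rw [List.getD_eq_default _ _ h]
  exact ⟨rfl, rfl⟩

/-- The element of `ℤ^I` coded by `n`, for the order of indices given by `p`. -/
noncomputable def decodeZ (p : Baire) (n : ℕ) : ZPow (Idx p) :=
  toColex (Finsupp.onFinset (Idx.initial p (codeLength n))
    (fun i : ℕ => (posCoeff n i : ℤ) - negCoeff n i) fun (i : ℕ) hi => by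
      refine Idx.mem_initial.2 ?_
      by_contra h
      obtain ⟨h1, h2⟩ := coeff_eq_zero (not_lt.1 h)
      exact hi (by rw [h1, h2, sub_self]))

theorem decodeZ_apply (p : Baire) (n i : ℕ) :
    ofColex (decodeZ p n) (show Idx p from i) = (posCoeff n i : ℤ) - negCoeff n i := rfl

theorem decodeZ_surjective (p : Baire) : Function.Surjective (decodeZ p) := by
  intro x
  let S : Finset ℕ := (ofColex x).support
  let N := S.sup id + 1
  let y (i : ℕ) : ℤ := ofColex x (show Idx p from i)
  have hN : ∀ i, N ≤ i → y i = 0 := by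
    intro i hi
    by_contra h
    have h1 : i ∈ S := Finsupp.mem_support_iff.2 h
    have h2 := Finset.le_sup (f := id) h1
    simp only [id] at h2
    omega
  let l : List (ℕ × ℕ) := (List.range N).map fun i => ((y i).toNat, (-y i).toNat)
  refine ⟨Encodable.encode l, ofColex.injective (Finsupp.ext fun (i : ℕ) => ?_)⟩
  have hl : pairList (Encodable.encode l) = l := Denumerable.ofNat_encode l
  refine (decodeZ_apply p _ i).trans (Eq.trans ?_ (rfl : y i = _))
  unfold posCoeff negCoeff
  rw [hl]
  by_cases h : i < N
  · rw [List.getD_eq_getElem _ _ (by simpa [l] using h)]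
    simp only [l, List.getElem_map, List.getElem_range]
    omega
  · rw [List.getD_eq_default _ _ (by simpa [l] using h), hN i (by omega)]
    simp

theorem primrec_pairList : Primrec pairList := Primrec.ofNat _

theorem primrec_posCoeff : Primrec₂ posCoeff :=
  Primrec.fst.comp ((Primrec.list_getD _).comp (primrec_pairList.comp Primrec.fst) Primrec.snd)

theorem primrec_negCoeff : Primrec₂ negCoeff :=
  Primrec.snd.comp ((Primrec.list_getD _).comp (primrec_pairList.comp Primrec.fst) Primrec.snd)

theorem primrec_codeLength : Primrec codeLength := Primrec.list_length.comp primrec_pairList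

/-- The `i`-th coefficients of the elements coded by `a` and `b` are equal. -/
abbrev CoeffEq (a b i : ℕ) : Prop := posCoeff a i + negCoeff b i = posCoeff b i + negCoeff a i

/-- The `i`-th coefficient of the element coded by `a` is less than that of `b`. -/
abbrev CoeffLT (a b i : ℕ) : Prop := posCoeff a i + negCoeff b i < posCoeff b i + negCoeff a i

theorem coeffEq_iff (p : Baire) {a b i : ℕ} : CoeffEq a b i ↔
    ofColex (decodeZ p a) (show Idx p from i) = ofColex (decodeZ p b) (show Idx p from i) := by
  rw [decodeZ_apply, decodeZ_apply, CoeffEq]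
  omega

theorem coeffLT_iff (p : Baire) {a b i : ℕ} : CoeffLT a b i ↔
    ofColex (decodeZ p a) (show Idx p from i) < ofColex (decodeZ p b) (show Idx p from i) := by
  rw [decodeZ_apply, decodeZ_apply, CoeffLT]
  omega

theorem coeffEq_of_le {a b i : ℕ} (h : codeLength a + codeLength b ≤ i) : CoeffEq a b i := by
  obtain ⟨h1, h2⟩ := coeff_eq_zero (n := a) (i := i) (by omega)
  obtain ⟨h3, h4⟩ := coeff_eq_zero (n := b) (i := i) (by omega)
  rw [CoeffEq, h1, h2, h3, h4]

/-- The numbers `a` and `b` code the same element. -/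
abbrev CodeEq (a b : ℕ) : Prop := ∀ i < codeLength a + codeLength b, CoeffEq a b i

/-- The left side does not involve `p`: the sequence influences only the order of the indices, so
domain and addition of the coded group are the same for all `p`. -/
theorem codeEq_iff (p : Baire) {a b : ℕ} : CodeEq a b ↔ decodeZ p a = decodeZ p b := by
  constructor
  · refine fun h => ofColex.injective (Finsupp.ext fun (i : ℕ) => (coeffEq_iff p).1 ?_)
    by_cases hi : i < codeLength a + codeLength b
    · exact h i hi
    · exact coeffEq_of_le (not_lt.1 hi)
  · intro h i _
    rw [coeffEq_iff p, h]

/-- The number `c` codes the sum of the elements coded by `a` and `b`. -/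
abbrev CodeSum (a b c : ℕ) : Prop := ∀ i < codeLength a + codeLength b + codeLength c,
  posCoeff c i + negCoeff a i + negCoeff b i = posCoeff a i + posCoeff b i + negCoeff c i

theorem codeSum_iff (p : Baire) {a b c : ℕ} :
    CodeSum a b c ↔ decodeZ p c = decodeZ p a + decodeZ p b := by
  have key : ∀ i : ℕ, posCoeff c i + negCoeff a i + negCoeff b i =
      posCoeff a i + posCoeff b i + negCoeff c i ↔
      ofColex (decodeZ p c) (show Idx p from i) =
        ofColex (decodeZ p a + decodeZ p b) (show Idx p from i) := by
    intro i
    rw [ofColex_add, Finsupp.add_apply, decodeZ_apply, decodeZ_apply, decodeZ_apply]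
    omega
  constructor
  · refine fun h => ofColex.injective (Finsupp.ext fun (i : ℕ) => (key i).1 ?_)
    by_cases hi : i < codeLength a + codeLength b + codeLength c
    · exact h i hi
    · obtain ⟨h1, h2⟩ := coeff_eq_zero (n := a) (i := i) (by omega)
      obtain ⟨h3, h4⟩ := coeff_eq_zero (n := b) (i := i) (by omega)
      obtain ⟨h5, h6⟩ := coeff_eq_zero (n := c) (i := i) (by omega)
      rw [h1, h2, h3, h4, h5, h6]
  · intro h i _
    rw [key, h]

/-- No smaller number codes the same element. -/
abbrev Canonical (n : ℕ) : Prop := ∀ k < n, ¬ CodeEq k n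

theorem Canonical.eq_of_decodeZ_eq (p : Baire) {a b : ℕ} (ha : Canonical a) (hb : Canonical b)
    (h : decodeZ p a = decodeZ p b) : a = b := by
  rcases lt_trichotomy a b with hlt | hlt | hlt
  · exact absurd ((codeEq_iff p).2 h) (hb a hlt)
  · exact hlt
  · exact absurd ((codeEq_iff p).2 h.symm) (ha b hlt)

theorem exists_codeSum (a b : ℕ) : ∃ c, CodeSum a b c := by
  -- The sequence `0` is an arbitrary choice, since `CodeSum` does not depend on it.
  obtain ⟨c, hc⟩ := decodeZ_surjective 0 (decodeZ 0 a + decodeZ 0 b)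
  exact ⟨c, (codeSum_iff 0).2 hc⟩

/-- The least code of the sum of the elements coded by `a` and `b`. -/
def addCode (a b : ℕ) : ℕ := Nat.find (exists_codeSum a b)

theorem decodeZ_addCode (p : Baire) (a b : ℕ) :
    decodeZ p (addCode a b) = decodeZ p a + decodeZ p b :=
  (codeSum_iff p).1 (Nat.find_spec (exists_codeSum a b))

theorem canonical_addCode (a b : ℕ) : Canonical (addCode a b) := fun k hk h =>
  Nat.find_min (exists_codeSum a b) hk ((codeSum_iff 0).2 (by
    rw [(codeEq_iff 0).1 h]
    exact decodeZ_addCode 0 a b))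

theorem exists_canonical (p : Baire) (x : ZPow (Idx p)) : ∃ n, Canonical n ∧ decodeZ p n = x := by
  classical
  have h := decodeZ_surjective p x
  exact ⟨Nat.find h, fun k hk hkn => Nat.find_min h hk
    (((codeEq_iff p).1 hkn).trans (Nat.find_spec h)), Nat.find_spec h⟩

theorem primrec_codeEq : PrimrecRel CodeEq := by
  have ha : Primrec fun x : (ℕ × ℕ) × ℕ => x.1.1 := Primrec.fst.comp Primrec.fst
  have hb : Primrec fun x : (ℕ × ℕ) × ℕ => x.1.2 := Primrec.snd.comp Primrec.fst
  exact primrecPred_forall_lt (R := fun (x : ℕ × ℕ) i => CoeffEq x.1 x.2 i)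
    (Primrec.eq.comp
      (Primrec.nat_add.comp (primrec_posCoeff.comp ha Primrec.snd)
        (primrec_negCoeff.comp hb Primrec.snd))
      (Primrec.nat_add.comp (primrec_posCoeff.comp hb Primrec.snd)
        (primrec_negCoeff.comp ha Primrec.snd)))
    (Primrec.nat_add.comp (primrec_codeLength.comp Primrec.fst)
      (primrec_codeLength.comp Primrec.snd))

theorem primrec_canonical : PrimrecPred Canonical :=
  primrecPred_forall_lt (R := fun n k => ¬ CodeEq k n)
    (PrimrecPred.not (primrec_codeEq.comp Primrec.snd Primrec.fst)) Primrec.id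

theorem primrec_codeSum : PrimrecPred fun x : (ℕ × ℕ) × ℕ => CodeSum x.1.1 x.1.2 x.2 := by
  have ha : Primrec fun x : (ℕ × ℕ) × ℕ => x.1.1 := Primrec.fst.comp Primrec.fst
  have hb : Primrec fun x : (ℕ × ℕ) × ℕ => x.1.2 := Primrec.snd.comp Primrec.fst
  have hc : Primrec fun x : (ℕ × ℕ) × ℕ => x.2 := Primrec.snd
  have hi : Primrec fun x : ((ℕ × ℕ) × ℕ) × ℕ => x.2 := Primrec.snd
  have pa : Primrec fun x : ((ℕ × ℕ) × ℕ) × ℕ => posCoeff x.1.1.1 x.2 :=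
    primrec_posCoeff.comp (ha.comp Primrec.fst) hi
  have pb : Primrec fun x : ((ℕ × ℕ) × ℕ) × ℕ => posCoeff x.1.1.2 x.2 :=
    primrec_posCoeff.comp (hb.comp Primrec.fst) hi
  have pc : Primrec fun x : ((ℕ × ℕ) × ℕ) × ℕ => posCoeff x.1.2 x.2 :=
    primrec_posCoeff.comp (hc.comp Primrec.fst) hi
  have na : Primrec fun x : ((ℕ × ℕ) × ℕ) × ℕ => negCoeff x.1.1.1 x.2 :=
    primrec_negCoeff.comp (ha.comp Primrec.fst) hi
  have nb : Primrec fun x : ((ℕ × ℕ) × ℕ) × ℕ => negCoeff x.1.1.2 x.2 :=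
    primrec_negCoeff.comp (hb.comp Primrec.fst) hi
  have nc : Primrec fun x : ((ℕ × ℕ) × ℕ) × ℕ => negCoeff x.1.2 x.2 :=
    primrec_negCoeff.comp (hc.comp Primrec.fst) hi
  have hl : Primrec fun x : ((ℕ × ℕ) × ℕ) × ℕ =>
      posCoeff x.1.2 x.2 + negCoeff x.1.1.1 x.2 + negCoeff x.1.1.2 x.2 :=
    Primrec.nat_add.comp (Primrec.nat_add.comp pc na) nb
  have hr : Primrec fun x : ((ℕ × ℕ) × ℕ) × ℕ =>
      posCoeff x.1.1.1 x.2 + posCoeff x.1.1.2 x.2 + negCoeff x.1.2 x.2 :=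
    Primrec.nat_add.comp (Primrec.nat_add.comp pa pb) nc
  have hR : PrimrecRel fun (x : (ℕ × ℕ) × ℕ) i =>
      posCoeff x.2 i + negCoeff x.1.1 i + negCoeff x.1.2 i =
        posCoeff x.1.1 i + posCoeff x.1.2 i + negCoeff x.2 i := Primrec.eq.comp hl hr
  have hN : Primrec fun x : (ℕ × ℕ) × ℕ => codeLength x.1.1 + codeLength x.1.2 + codeLength x.2 :=
    Primrec.nat_add.comp (Primrec.nat_add.comp
      (primrec_codeLength.comp ha) (primrec_codeLength.comp hb)) (primrec_codeLength.comp hc)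
  exact primrecPred_forall_lt hR hN

theorem computable_addCode : Computable₂ addCode := by
  have h : Computable₂ fun (x : ℕ × ℕ) c => decide (CodeSum x.1 x.2 c) :=
    primrec_codeSum.decide.to_comp
  refine (Partrec.rfind (p := fun (x : ℕ × ℕ) c => Part.some (decide (CodeSum x.1 x.2 c)))
    h.partrec₂).of_eq_tot fun x => ?_
  refine Nat.mem_rfind.2 ⟨?_, fun {k} hk => ?_⟩
  · exact Part.mem_some_iff.2 (decide_eq_true (Nat.find_spec (exists_codeSum x.1 x.2))).symm
  · exact Part.mem_some_iff.2 (decide_eq_false (Nat.find_min (exists_codeSum x.1 x.2) hk)).symm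

/-- The level of `i`, computed from a long enough initial segment. -/
def listLevel (σ : List ℕ) (i : ℕ) : ℕ := (σ.take (i + 1)).foldr min i

theorem listLevel_initSeg {p : Baire} {a i : ℕ} (h : i < a) :
    listLevel (initSeg p a) i = level p i := by
  rw [listLevel, take_initSeg p h, level]

/-- The order of the indices, computed from a long enough initial segment. -/
abbrev ListLT (σ : List ℕ) (i j : ℕ) : Prop :=
  listLevel σ i < listLevel σ j ∨ listLevel σ i = listLevel σ j ∧ j < i

/-- The order of the elements coded by `a` and `b`, computed from a long enough initial segment. -/
abbrev CodeLT (σ : List ℕ) (a b : ℕ) : Prop := ∃ i < codeLength a + codeLength b,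
  CoeffLT a b i ∧ ∀ j < codeLength a + codeLength b, ListLT σ i j → CoeffEq a b j

/-- Both elements vanish from `codeLength a + codeLength b` on, and the level of an index `i`
depends only on the first `i + 1` terms of `p`, so this prefix decides the comparison. -/
theorem codeLT_initSeg_iff {p : Baire} {n a b : ℕ} (h : codeLength a + codeLength b ≤ n) :
    CodeLT (initSeg p n) a b ↔ decodeZ p a < decodeZ p b := by
  have hlt : ∀ i < codeLength a + codeLength b, ∀ j < codeLength a + codeLength b,
      (ListLT (initSeg p n) i j ↔ (show Idx p from i) < (show Idx p from j)) := by
    intro i hi j hj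
    rw [Idx.lt_iff, ListLT, listLevel_initSeg (by omega), listLevel_initSeg (by omega)]
  rw [zpow_lt_iff]
  constructor
  · rintro ⟨i, hi, hlti, H⟩
    refine ⟨i, fun (j : ℕ) hj => (coeffEq_iff p).1 ?_, (coeffLT_iff p).1 hlti⟩
    by_cases hjN : j < codeLength a + codeLength b
    · exact H j hjN ((hlt i hi j hjN).2 hj)
    · exact coeffEq_of_le (not_lt.1 hjN)
  · rintro ⟨(i : ℕ), H, hi⟩
    have hi' := (coeffLT_iff p).2 hi
    have hiN : i < codeLength a + codeLength b := by
      by_contra hiN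
      have := coeffEq_of_le (not_lt.1 hiN)
      rw [CoeffEq] at this
      rw [CoeffLT] at hi'
      omega
    exact ⟨i, hiN, hi', fun j hj hij => (coeffEq_iff p).2 (H j ((hlt i hiN j hj).1 hij))⟩

theorem primrec_listLevel : Primrec₂ listLevel :=
  Primrec.list_foldr (Primrec.list_take.comp (Primrec.succ.comp Primrec.snd) Primrec.fst)
    Primrec.snd (Primrec.nat_min.comp (Primrec.fst.comp Primrec.snd)
      (Primrec.snd.comp Primrec.snd)).to₂

theorem primrec_codeLT : PrimrecPred fun x : List ℕ × ℕ × ℕ => CodeLT x.1 x.2.1 x.2.2 := by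
  have ha : Primrec fun x : List ℕ × ℕ × ℕ => x.2.1 := Primrec.fst.comp Primrec.snd
  have hb : Primrec fun x : List ℕ × ℕ × ℕ => x.2.2 := Primrec.snd.comp Primrec.snd
  have hN : Primrec fun x : List ℕ × ℕ × ℕ => codeLength x.2.1 + codeLength x.2.2 :=
    Primrec.nat_add.comp (primrec_codeLength.comp ha) (primrec_codeLength.comp hb)
  have h1 : Primrec fun x : (List ℕ × ℕ × ℕ) × ℕ => posCoeff x.1.2.1 x.2 + negCoeff x.1.2.2 x.2 :=
    Primrec.nat_add.comp (primrec_posCoeff.comp (ha.comp Primrec.fst) Primrec.snd)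
      (primrec_negCoeff.comp (hb.comp Primrec.fst) Primrec.snd)
  have h2 : Primrec fun x : (List ℕ × ℕ × ℕ) × ℕ => posCoeff x.1.2.2 x.2 + negCoeff x.1.2.1 x.2 :=
    Primrec.nat_add.comp (primrec_posCoeff.comp (hb.comp Primrec.fst) Primrec.snd)
      (primrec_negCoeff.comp (ha.comp Primrec.fst) Primrec.snd)
  have hσ : Primrec fun x : ((List ℕ × ℕ × ℕ) × ℕ) × ℕ => x.1.1.1 :=
    Primrec.fst.comp (Primrec.fst.comp Primrec.fst)
  have hi : Primrec fun x : ((List ℕ × ℕ × ℕ) × ℕ) × ℕ => x.1.2 := Primrec.snd.comp Primrec.fst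
  have hli : Primrec fun x : ((List ℕ × ℕ × ℕ) × ℕ) × ℕ => listLevel x.1.1.1 x.1.2 :=
    primrec_listLevel.comp hσ hi
  have hlj : Primrec fun x : ((List ℕ × ℕ × ℕ) × ℕ) × ℕ => listLevel x.1.1.1 x.2 :=
    primrec_listLevel.comp hσ Primrec.snd
  have hlt : PrimrecPred fun x : ((List ℕ × ℕ × ℕ) × ℕ) × ℕ => ListLT x.1.1.1 x.1.2 x.2 :=
    (Primrec.nat_lt.comp hli hlj).or ((Primrec.eq.comp hli hlj).and
      (Primrec.nat_lt.comp Primrec.snd hi))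
  have heq : PrimrecPred fun x : ((List ℕ × ℕ × ℕ) × ℕ) × ℕ => CoeffEq x.1.1.2.1 x.1.1.2.2 x.2 :=
    Primrec.eq.comp (h1.comp ((Primrec.fst.comp Primrec.fst).pair Primrec.snd))
      (h2.comp ((Primrec.fst.comp Primrec.fst).pair Primrec.snd))
  have himp : PrimrecPred fun x : ((List ℕ × ℕ × ℕ) × ℕ) × ℕ =>
      ListLT x.1.1.1 x.1.2 x.2 → CoeffEq x.1.1.2.1 x.1.1.2.2 x.2 :=
    (hlt.not.or heq).of_eq fun x => imp_iff_not_or.symm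
  have hall : PrimrecPred fun x : (List ℕ × ℕ × ℕ) × ℕ =>
      ∀ j < codeLength x.1.2.1 + codeLength x.1.2.2,
        ListLT x.1.1 x.2 j → CoeffEq x.1.2.1 x.1.2.2 j :=
    primrecPred_forall_lt (R := fun (x : (List ℕ × ℕ × ℕ) × ℕ) j =>
      ListLT x.1.1 x.2 j → CoeffEq x.1.2.1 x.1.2.2 j) himp (hN.comp Primrec.fst)
  exact primrecPred_exists_lt (R := fun (x : List ℕ × ℕ × ℕ) i => CoeffLT x.2.1 x.2.2 i ∧
    ∀ j < codeLength x.2.1 + codeLength x.2.2, ListLT x.1 i j → CoeffEq x.2.1 x.2.2 j)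
    ((Primrec.nat_lt.comp h1 h2).and hall) hN

end Codes

/-! ### The ordered group computed from a sequence -/

section CodedGroup

/-- The canonical codes, as the elements of `ℤ^I`. -/
noncomputable def codeEquiv (p : Baire) :
    {n | Canonical n} ≃ Multiplicative (ZPow (Idx p)) :=
  Equiv.ofBijective (fun n => Multiplicative.ofAdd (decodeZ p n.1))
    ⟨fun a b h => Subtype.ext (a.2.eq_of_decodeZ_eq p b.2 (Multiplicative.ofAdd.injective h)),
      fun x => by
        obtain ⟨n, hn, e⟩ := exists_canonical p x.toAdd
        exact ⟨⟨n, hn⟩, congrArg Multiplicative.ofAdd e⟩⟩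

/-- The ordered group `ℤ^I` on the canonical codes of its elements. -/
noncomputable def codedGroup (p : Baire) : NatOrderedGroup where
  carrier := {n | Canonical n}
  group := (codeEquiv p).group
  linearOrder := LinearOrder.lift' (fun a => (codeEquiv p a).toAdd)
    (Multiplicative.toAdd.injective.comp (codeEquiv p).injective)
  mul_le_mul_right a b g h := by
    let _ : Group {n | Canonical n} := (codeEquiv p).group
    have hmul : ∀ x y, codeEquiv p (x * y) = codeEquiv p x * codeEquiv p y := fun x y =>
      (codeEquiv p).apply_symm_apply _
    change (codeEquiv p (a * g)).toAdd ≤ (codeEquiv p (b * g)).toAdd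
    rw [hmul, hmul, toAdd_mul, toAdd_mul]
    exact add_le_add_left (show (codeEquiv p a).toAdd ≤ (codeEquiv p b).toAdd from h) _
  mul_le_mul_left a b g h := by
    let _ : Group {n | Canonical n} := (codeEquiv p).group
    have hmul : ∀ x y, codeEquiv p (x * y) = codeEquiv p x * codeEquiv p y := fun x y =>
      (codeEquiv p).apply_symm_apply _
    change (codeEquiv p (g * a)).toAdd ≤ (codeEquiv p (g * b)).toAdd
    rw [hmul, hmul, toAdd_mul, toAdd_mul]
    exact add_le_add_right (show (codeEquiv p a).toAdd ≤ (codeEquiv p b).toAdd from h) _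

/-- The isomorphism of the coded group with `ℤ^I`. -/
noncomputable def codedGroupIso (p : Baire) : (codedGroup p).Elem ≃o ZPow (Idx p) where
  toEquiv := (codeEquiv p).trans Multiplicative.toAdd
  map_rel_iff' := Iff.rfl

theorem codedGroupIso_apply (p : Baire) (a : (codedGroup p).Elem) :
    codedGroupIso p a = decodeZ p a.toNat := rfl

theorem codedGroup_toNat_mul (p : Baire) (a b : (codedGroup p).Elem) :
    (a * b).toNat = addCode a.toNat b.toNat := by
  refine Canonical.eq_of_decodeZ_eq p (a * b).2 (canonical_addCode _ _) ?_
  rw [decodeZ_addCode]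
  change ((codeEquiv p) ((codeEquiv p).symm (codeEquiv p a * codeEquiv p b))).toAdd = _
  rw [Equiv.apply_symm_apply]
  rfl

theorem exists_functional_codedGroup : ∃ Φ : Baire →. Baire, ComputableFunctional Φ ∧
    ∀ p, ∃ q ∈ Φ p, CodesGroup q (codedGroup p) := by
  let a (n : ℕ) : ℕ := (n / 3).unpair.1
  let b (n : ℕ) : ℕ := (n / 3).unpair.2
  have hdiv : Primrec fun n : ℕ => n / 3 := Primrec.nat_div.comp Primrec.id (Primrec.const 3)
  have ha : Primrec a := Primrec.fst.comp (Primrec.unpair.comp hdiv)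
  have hb : Primrec b := Primrec.snd.comp (Primrec.unpair.comp hdiv)
  have hmod : ∀ k, Computable fun x : List ℕ × ℕ => decide (x.2 % 3 = k) := fun k =>
    (Primrec.eq.comp (Primrec.nat_mod.comp Primrec.snd (Primrec.const 3))
      (Primrec.const k)).decide.to_comp
  obtain ⟨Φ, cΦ, HΦ⟩ := exists_functional (h := fun σ n =>
      bif decide (n % 3 = 0) then some (if Canonical (n / 3) then 1 else 0)
      else bif decide (n % 3 = 1) then some (addCode (a n) (b n))
      -- The order bit is computed as the negation of the strict reverse comparison, once the prefix
      -- is long enough to decide it.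
      else if codeLength (b n) + codeLength (a n) ≤ σ.length then
        some (if CodeLT σ (b n) (a n) then 0 else 1) else none) (by
    refine Computable.cond (hmod 0) (Primrec.to_comp ?_) (Computable.cond (hmod 1) ?_
      (Primrec.to_comp ?_))
    · exact Primrec.option_some.comp (Primrec.ite (primrec_canonical.comp (hdiv.comp Primrec.snd))
        (Primrec.const 1) (Primrec.const 0))
    · exact Computable.option_some.comp (computable_addCode.comp (ha.comp Primrec.snd).to_comp
        (hb.comp Primrec.snd).to_comp)
    · exact Primrec.ite (Primrec.nat_le.comp (Primrec.nat_add.comp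
        (primrec_codeLength.comp (hb.comp Primrec.snd))
        (primrec_codeLength.comp (ha.comp Primrec.snd)))
        (Primrec.list_length.comp Primrec.fst))
        (Primrec.option_some.comp (Primrec.ite (primrec_codeLT.comp (Primrec.fst.pair
          ((hb.comp Primrec.snd).pair (ha.comp Primrec.snd)))) (Primrec.const 0)
          (Primrec.const 1))) (Primrec.const none))
  refine ⟨Φ, cΦ, fun p => ?_⟩
  obtain ⟨q, hq, hqn⟩ := HΦ p fun n => by
    refine ⟨codeLength (b n) + codeLength (a n), ?_⟩
    by_cases h0 : n % 3 = 0
    · simp [h0]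
    · by_cases h1 : n % 3 = 1
      · simp [h1]
      · simp [h0, h1]
  refine ⟨q, hq, fun n => ?_, fun x y => ?_, fun x y => ?_⟩
  · obtain ⟨m, hm⟩ := hqn (3 * n)
    simp only [Nat.mul_mod_right, decide_true, cond_true, ne_eq, OfNat.ofNat_ne_zero,
      not_false_eq_true, mul_div_cancel_left₀, Option.some.injEq] at hm
    rw [← hm]
    by_cases h : Canonical n
    · exact (if_pos h).trans (if_pos (show n ∈ (codedGroup p).carrier from h)).symm
    · exact (if_neg h).trans (if_neg (show n ∉ (codedGroup p).carrier from h)).symm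
  · obtain ⟨m, hm⟩ := hqn (3 * Nat.pair x.toNat y.toNat + 1)
    have e0 : (3 * Nat.pair x.toNat y.toNat + 1) % 3 = 1 := by omega
    have e2 : (3 * Nat.pair x.toNat y.toNat + 1) / 3 = Nat.pair x.toNat y.toNat := by omega
    simp only [e0, a, b, e2, Nat.unpair_pair, one_ne_zero, decide_false, decide_true, cond_true,
      cond_false, Option.some.injEq] at hm
    rw [← hm, codedGroup_toNat_mul]
  · obtain ⟨m, hm⟩ := hqn (3 * Nat.pair x.toNat y.toNat + 2)
    have e0 : (3 * Nat.pair x.toNat y.toNat + 2) % 3 = 2 := by omega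
    have e2 : (3 * Nat.pair x.toNat y.toNat + 2) / 3 = Nat.pair x.toNat y.toNat := by omega
    have e3 : (2 : ℕ) ≠ 1 := by decide
    simp only [e0, a, b, e2, Nat.unpair_pair, OfNat.ofNat_ne_zero, e3, decide_false,
      cond_false] at hm
    by_cases h1 : codeLength y.toNat + codeLength x.toNat ≤ (initSeg p m).length
    · rw [if_pos h1] at hm
      rw [length_initSeg] at h1
      rw [← Option.some.inj hm]
      have h2 : CodeLT (initSeg p m) y.toNat x.toNat ↔ y < x := by
        rw [codeLT_initSeg_iff h1, ← (codedGroupIso p).lt_iff_lt, codedGroupIso_apply,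
          codedGroupIso_apply]
      by_cases h : y < x
      · rw [if_pos (h2.2 h), if_neg (not_le.2 h)]
      · rw [if_neg (fun h' => h (h2.1 h')), if_pos (not_lt.1 h)]
    · rw [if_neg h1] at hm
      simp at hm

end CodedGroup

/-! ### The lower bound -/

section LowerBound

/-- The number of elements that the string `τ` enumerates into the copy of an ordinal. -/
def enumerated (τ : List ℕ) : ℕ :=
  ((List.range τ.length).filter fun i => τ.getD (2 * i) 0 = 1).length

theorem primrec_enumerated : Primrec enumerated :=
  Primrec.list_length.comp ((PrimrecRel.listFilter (R := fun (i : ℕ) (τ : List ℕ) =>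
    τ.getD (2 * i) 0 = 1) (Primrec.eq.comp ((Primrec.list_getD 0).comp Primrec.snd
      (Primrec.nat_double.comp Primrec.fst)) (Primrec.const 1))).comp
    (Primrec.list_range.comp Primrec.list_length) Primrec.id)

theorem enumerated_eq_card (τ : List ℕ) :
    enumerated τ = ((Finset.range τ.length).filter fun i => τ.getD (2 * i) 0 = 1).card := rfl

/-- A copy of `m` has exactly `m` labels. Unread entries count as absent, so the count never exceeds
`m`, and it is `m` once the largest label has been passed. -/
theorem IsCopy.enumerated {r : Baire} {m : ℕ} (h : IsCopy r (m : Ordinal.{0})) :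
    (∀ a, enumerated (initSeg r a) ≤ m) ∧ ∃ a₀, ∀ a ≥ a₀, enumerated (initSeg r a) = m := by
  obtain ⟨f, hf, rfl⟩ := h.exists_eq_copyName
  obtain ⟨g⟩ := Ordinal.type_eq.1
    ((Ordinal.type_fin m).trans (Ordinal.type_toType (m : Ordinal.{0})).symm)
  let T : Finset ℕ := Finset.univ.map ⟨f ∘ g, hf.comp g.injective⟩
  have hT : T.card = m := by simp [T]
  have hmem : ∀ i, copyName f (2 * i) = 1 ↔ i ∈ T := by
    intro i
    refine mem_copySet_copyName.trans ?_
    simp only [T, Finset.mem_map, Finset.mem_univ, true_and, Function.Embedding.coeFn_mk,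
      Function.comp_apply]
    constructor
    · rintro ⟨x, hx⟩
      exact ⟨g.symm x, by rwa [g.apply_symm_apply]⟩
    · rintro ⟨x, hx⟩
      exact ⟨g x, hx⟩
  constructor
  · intro a
    rw [enumerated_eq_card]
    refine (Finset.card_le_card (t := T) fun i hi => ?_).trans hT.le
    have hi' := (Finset.mem_filter.1 hi).2
    by_cases h2 : 2 * i < a
    · rwa [getD_initSeg h2, hmem] at hi'
    · rw [List.getD_eq_default _ _ (by rw [length_initSeg]; omega)] at hi'
      simp at hi'
  · refine ⟨2 * T.sup id + 1, fun a ha => ?_⟩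
    rw [enumerated_eq_card]
    refine Eq.trans (congrArg Finset.card (Finset.ext fun i => ?_)) hT
    rw [Finset.mem_filter, Finset.mem_range, length_initSeg]
    constructor
    · rintro ⟨-, hi⟩
      by_cases h2 : 2 * i < a
      · rwa [getD_initSeg h2, hmem] at hi
      · rw [List.getD_eq_default _ _ (by rw [length_initSeg]; omega)] at hi
        simp at hi
    · intro hi
      have := Finset.le_sup (f := id) hi
      simp only [id] at this
      exact ⟨by omega, by rw [getD_initSeg (by omega), hmem]; exact hi⟩

/-- The group coded from `p` has order type `ℤ^m ℚ`, and every admissible exponent equals the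
minimum `m`. A term of `p` equal to a count of enumerated points is at most `m`, hence is the
minimum; such a coincidence is eventually found. -/
theorem min_wle_OGalpha : WLE Min OGalpha := by
  obtain ⟨Φ, cΦ, HΦ⟩ := exists_functional_codedGroup
  obtain ⟨Ψ, cΨ, HΨ⟩ := exists_functional_join_nat (h := fun σ τ => firstSome
    (fun i => (σ[i]?).bind fun v => if v = enumerated τ then some v else none) σ.length) (by
    refine computable_firstSome (Primrec.to_comp ?_) (Computable.list_length.comp Computable.fst)
    exact Primrec.option_bind
      (Primrec.list_getElem?.comp (Primrec.fst.comp Primrec.fst) Primrec.snd)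
      (Primrec.ite (Primrec.eq.comp Primrec.snd (primrec_enumerated.comp
        (Primrec.snd.comp (Primrec.fst.comp Primrec.fst))))
        (Primrec.option_some.comp Primrec.snd) (Primrec.const none)).to₂)
  refine ⟨Φ, Ψ, cΦ, cΨ, ?_⟩
  rintro p x rfl ⟨(m : ℕ), hm : IsLeast (Set.range p) m⟩
  obtain ⟨q, hq, hqG⟩ := HΦ p
  have hlow := Idx.isLowerSet_initial hm
  have hdense := Idx.exists_lt_of_notMem_initial hm
  refine ⟨q, hq, codedGroup p, hqG, ?_, ?_⟩
  · obtain ⟨e⟩ := zpow_iso_rat_prod hlow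
      ⟨(m : ℕ), fun h => lt_irrefl _ (Idx.mem_initial.1 h)⟩ hdense
    refine ⟨⟨((Idx.initial p m).card : Ordinal.{0}), ?_⟩, Or.inr ⟨(codedGroupIso p).trans e⟩⟩
    rw [Ordinal.card_nat]
    exact (Cardinal.natCast_lt_aleph0).le
  · rintro r ⟨α, hα⟩ hr hG
    -- The solution may present the group in either shape; the condensation invariant gives the same
    -- exponent.
    obtain rfl : α = m := by
      have h := HasOrderType.eq_natCast hG hlow hdense (codedGroupIso p)
      rwa [Idx.card_initial] at h
    obtain ⟨hle, a₀, ha₀⟩ := IsCopy.enumerated hr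
    obtain ⟨⟨n, hn⟩, hmin⟩ := hm
    obtain ⟨s, hs, a, b, v, hv, hsv⟩ := HΨ p r ⟨max (n + 1) a₀, by
      have h1 : n < max (n + 1) a₀ := lt_of_lt_of_le n.lt_succ_self (le_max_left _ _)
      refine firstSome_isSome (i := n) (v := m) (by rwa [length_initSeg]) ?_
      rw [getElem?_initSeg, if_pos h1, Option.bind_some, hn, if_pos]
      exact (ha₀ _ (le_max_right _ _)).symm⟩
    refine ⟨s, hs, v, hsv, ?_⟩
    obtain ⟨i, -, hi⟩ := exists_of_firstSome hv
    rw [getElem?_initSeg] at hi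
    split_ifs at hi
    · rw [Option.bind_some] at hi
      split_ifs at hi with h2
      obtain rfl : p i = v := Option.some.inj hi
      refine ⟨⟨i, rfl⟩, fun w hw => ?_⟩
      rw [h2]
      exact (hle b).trans (hmin hw)
    · simp at hi

end LowerBound

end Weihrauch

theorem mainTheorem6 :
    -- the first-order part of `OG ↦ α` exists, and it is equivalent to `LPO^*`
    (∃ (Z : Weihrauch.RepSpace.{0}) (Q : Weihrauch.Problem Z Weihrauch.natRep),
      Weihrauch.IsFirstOrderPart Q Weihrauch.OGalpha) ∧
    (∀ (Z : Weihrauch.RepSpace.{0}) (Q : Weihrauch.Problem Z Weihrauch.natRep),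
      Weihrauch.IsFirstOrderPart Q Weihrauch.OGalpha →
        Weihrauch.WEquiv Q (Weihrauch.star Weihrauch.LPO)) ∧
    -- `LPO^*` is equivalent to `Min`
    Weihrauch.WEquiv (Weihrauch.star Weihrauch.LPO) Weihrauch.Min ∧
    -- the upper bound, for every problem that outputs a copy of an ordinal
    (∀ (X : Weihrauch.RepSpace.{u}) (P : Weihrauch.Problem X Weihrauch.ordRep)
      (Z : Weihrauch.RepSpace.{v}) (Q : Weihrauch.Problem Z Weihrauch.natRep),
      Weihrauch.WLE Q P → Weihrauch.WLE Q (Weihrauch.star Weihrauch.LPO)) ∧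
    -- the lower bound
    Weihrauch.WLE (Weihrauch.star Weihrauch.LPO) Weihrauch.OGalpha := by
  have hlow := Weihrauch.min_wle_OGalpha
  have hmin : Weihrauch.IsFirstOrderPart Weihrauch.Min Weihrauch.OGalpha :=
    ⟨hlow, fun _ _ h => Weihrauch.wle_min_of_wle_ordRep h⟩
  refine ⟨⟨_, _, hmin⟩, fun Z Q hQ => ⟨?_, ?_⟩,
    ⟨Weihrauch.star_lpo_wle_min, Weihrauch.min_wle_star_lpo⟩, fun X P Z Q h => ?_, ?_⟩
  · exact (Weihrauch.wle_min_of_wle_ordRep hQ.le).trans Weihrauch.min_wle_star_lpo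
  · exact Weihrauch.star_lpo_wle_min.trans (hQ.greatest _ _ hlow)
  · exact (Weihrauch.wle_min_of_wle_ordRep h).trans Weihrauch.min_wle_star_lpo
  · exact Weihrauch.star_lpo_wle_min.trans hlow
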